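/- For a real number $p\ge 0$ and $n\in\mathbb N$ let $G(n,p)$ denote the binomial random graph on $n$ labelled vertices, in which every pair of vertices is an edge independently with probability $\min\{p,1\}$. For every integer $\Delta\ge 2$ there exists a constant $C=C(\Delta)>0$ such that the following holds for every function $\alpha=\alpha(n)\colon\mathbb N\to(0,1)$, where $\beta=\beta(n)= C\,\alpha(n)^{-(\Delta+1)}\log\frac1{\alpha(n)}$. Let $G_\alpha$ be an $n$-vertex graph with minimum degree at least $\alpha(n)\, n$, and let $T$ be an $n$-vertex tree with maximum degree at most $\Delta$. Then asymptotically almost surely the union of $G_\alpha$ with $G(n,\beta/n)$ on the same vertex set contains a copy of $T$. That is, for every $\delta>0$ there is an $n_0$ (depending on $\Delta,\alpha,\delta$) such that for all $n\ge n_0$, every $n$-vertex graph $G_\alpha$ with minimum degree at least $\alpha(n)\,n$ and every $n$-vertex tree $T$ with maximum degree at most $\Delta$, $$\mathbb P\bigl(T\subseteq G_\alpha\cup G(n,\beta/n)\bigr)\ge 1-\delta .$$ -/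

import Mathlib

open Filter MeasureTheory
open scoped SimpleGraph

/-- The binomial random graph `G(n, p)` on the vertex set `Fin n`, as a probability measure.
The edge probability is `p` for `0 ≤ p ≤ 1`; values above `1` are read as `1`
(and negative values as `0`). -/
noncomputable def gnp (n : ℕ) (p : ℝ) : Measure (SimpleGraph (Fin n)) :=
  SimpleGraph.binomialRandom (Fin n) (Set.projIcc (0 : ℝ) 1 zero_le_one p)

/-- The probability that the randomly perturbed graph `G ∪ G(n, p)` contains a copy of `T`. -/
noncomputable def perturbedContainProb {n : ℕ} (G T : SimpleGraph (Fin n)) (p : ℝ) : ℝ :=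
  (gnp n p).real {H : SimpleGraph (Fin n) | T ⊑ G ⊔ H}

/-!
The proof combines an embedding of almost all of the tree into the random graph with absorption by
the dense graph. Write `s = α ^ (Δ + 1) * n`.

If `1 - α` is less than `1 / (4 Δ)`, no random edges are needed: the complement of `G` has small
degrees, and a bijection from `T` to `G` with fewest violated edges violates none
(`isContained_of_compl_degree_le`, the Sauer–Spencer argument). If `β ≥ n`, the random graph is
complete. Otherwise `β < n` forces `s` to exceed any prescribed multiple of `log n`, when `C` is
large.

In the remaining case fix `m` as a small multiple of `s`. With high probability the random graph
`H` is `m`-joined: any two disjoint sets of `m` vertices span an edge (`gnp_real_not_isJoined_le`;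
the factor `log (1 / α)` in `β` pays for the union bound). A Friedman–Pippenger type argument
(`Extendable.exists_insert`, `IsJoined.exists_embedding`) shows that every joined graph contains a
subtree of `T` on all but `L`, a constant multiple of `m`, of the vertices.

The remaining `L` vertices are added one at a time. To attach a new leaf at `x` while `u` is an
unused vertex, choose an *absorber*: a tree vertex `s` whose image is a `G`-neighbour of `x` and the
images of whose neighbours are `G`-neighbours of `u`. Move `s` to `u` and put the leaf in its old
place. Each step spoils at most `Δ + 2` absorbers, so it suffices that every pair `x, u` has more
than `(Δ + 3) * L` of them (`isContained_sup_of_absorbers`).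

As the distribution of `H` is invariant under relabelling, it may be relabelled by a uniformly
random permutation, so that the embedding becomes a random bijection, for which a vertex is an
absorber with probability about `α ^ (Δ + 1)`. Whether vertices are absorbers depends only on a
four-colouring of the points, and events about the colours are at most polynomially more likely for
random permutations than for functions with independent values (`card_perm_comp_mem_mul_le`). For
the latter, a linear number of disjoint stars of the tree gives independent events, and the number
of absorbers is at least a multiple of `s` but for an error exponentially small in `s`
(`card_perm_absorbers_lt_le`), which beats the polynomial factors since `s` is a large multiple of
`log n`.
-/

section RandomlyPerturbedTrees

open Finset
open scoped Classical

/-! ### Rooted trees -/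

/-- A rooting of a graph `T`: every vertex other than `root` has a parent of smaller depth, and the
edges of `T` are exactly the pairs consisting of a vertex and its parent. The value of `parent` at
the root is irrelevant. -/
structure Rooting {V : Type*} (T : SimpleGraph V) where
  /-- the root -/
  root : V
  /-- the parent function -/
  parent : V → V
  /-- a function that decreases from a vertex to its parent -/
  depth : V → ℕ
  depth_parent_lt : ∀ v, v ≠ root → depth (parent v) < depth v
  adj_iff : ∀ u v, T.Adj u v ↔ (u ≠ root ∧ parent u = v) ∨ (v ≠ root ∧ parent v = u)

theorem SimpleGraph.IsTree.nonempty_rooting {V : Type*} {T : SimpleGraph V} (hT : T.IsTree) :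
    Nonempty (Rooting T) := by
  obtain ⟨r⟩ := hT.connected.nonempty
  choose p hp hpl using fun v => (hT.connected r v).exists_path_of_dist
  have hpen : ∀ v, v ≠ r → T.Adj (p v).penultimate v := fun v hv =>
    (p v).adj_penultimate (SimpleGraph.Walk.not_nil_of_ne (Ne.symm hv))
  -- a neighbour of `v` that is not the penultimate vertex of the path to `v` is further away
  have hadj : ∀ v w, T.Adj v w → T.dist r v = T.dist r w + 1 → v ≠ r ∧ (p v).penultimate = w := by
    intro v w hvw hd
    have hv : v ∉ (p w).support := by
      intro hv
      have h1 := (p w).length_takeUntil_le_length hv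
      have h2 := SimpleGraph.dist_le ((p w).takeUntil v hv)
      have := hpl w
      omega
    refine ⟨?_, ?_⟩
    · rintro rfl
      simp at hd
    · have hw := hT.isAcyclic.mem_support_of_ne_mem_support_of_adj_of_isPath (hp v) (hp w) hvw hv
      exact (hT.isAcyclic.eq_penultimate_of_adj_end (hp v) hvw hw).symm
  have hlt : ∀ v, v ≠ r → T.dist r (p v).penultimate < T.dist r v := by
    intro v hv
    have h1 := SimpleGraph.dist_le (p v).dropLast
    have h2 := hpl v
    have h3 : 0 < T.dist r v := hT.connected.pos_dist_of_ne (Ne.symm hv)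
    have h4 : (p v).dropLast.length = (p v).length - 1 := by simp
    omega
  refine ⟨⟨r, fun v => (p v).penultimate, fun v => T.dist r v, hlt, ?_⟩⟩
  intro u v
  constructor
  · intro h
    rcases hT.dist_eq_dist_add_one_of_adj r h with h1 | h1
    · exact Or.inl (hadj u v h h1)
    · exact Or.inr (hadj v u h.symm h1)
  · rintro (⟨h, rfl⟩ | ⟨h, rfl⟩)
    · exact (hpen u h).symm
    · exact hpen v h

namespace Rooting

variable {V : Type*} {T : SimpleGraph V} (ρ : Rooting T)

/-- A set of vertices that contains the root and with each vertex its parent, that is, the vertex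
set of a subtree through the root. -/
def IsClosed (A : Finset V) : Prop :=
  ρ.root ∈ A ∧ ∀ v ∈ A, v ≠ ρ.root → ρ.parent v ∈ A

variable {ρ}

theorem adj_parent {v : V} (hv : v ≠ ρ.root) : T.Adj (ρ.parent v) v :=
  (ρ.adj_iff _ _).2 (Or.inr ⟨hv, rfl⟩)

theorem IsClosed.exists_insert [Fintype V] [DecidableEq V] {A : Finset V} (hA : ρ.IsClosed A)
    (hne : A ≠ univ) :
    ∃ v, v ∉ A ∧ v ≠ ρ.root ∧ ρ.parent v ∈ A ∧ ρ.IsClosed (insert v A) := by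
  obtain ⟨w, hw⟩ : ∃ w, w ∉ A := by
    by_contra! h
    exact hne (eq_univ_iff_forall.2 h)
  obtain ⟨v, hv, hmin⟩ := exists_min_image (univ.filter fun v => v ∉ A) ρ.depth ⟨w, by simpa⟩
  simp only [mem_filter, mem_univ, true_and] at hv hmin
  have hvr : v ≠ ρ.root := fun h => hv (h ▸ hA.1)
  have hpar : ρ.parent v ∈ A := by
    by_contra h
    exact absurd (ρ.depth_parent_lt v hvr) (not_lt.2 (hmin _ h))
  refine ⟨v, hv, hvr, hpar, mem_insert_of_mem hA.1, fun x hx hxr => ?_⟩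
  rcases mem_insert.1 hx with rfl | hx
  · exact mem_insert_of_mem hpar
  · exact mem_insert_of_mem (hA.2 x hx hxr)

/-- The only neighbour in a closed set of a vertex outside of it is the parent. -/
theorem IsClosed.eq_parent_of_adj {A : Finset V} (hA : ρ.IsClosed A) {v w : V} (hv : v ∉ A)
    (hw : w ∈ A) (h : T.Adj v w) : w = ρ.parent v := by
  rcases (ρ.adj_iff _ _).1 h with h | h
  · exact h.2.symm
  · exact absurd (h.2 ▸ hA.2 w hw h.1) hv

end Rooting

/-! ### Embedding almost spanning trees into joined graphs -/

section Joined

variable {V : Type*} [Fintype V]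

/-- The union of the neighbourhoods of the vertices in `U`. -/
noncomputable def nbrs (H : SimpleGraph V) (U : Finset V) : Finset V :=
  univ.filter fun x => ∃ u ∈ U, H.Adj u x

theorem mem_nbrs {H : SimpleGraph V} {U : Finset V} {x : V} :
    x ∈ nbrs H U ↔ ∃ u ∈ U, H.Adj u x := by
  simp [nbrs]

theorem nbrs_mono (H : SimpleGraph V) {U W : Finset V} (h : U ⊆ W) : nbrs H U ⊆ nbrs H W := by
  intro x hx
  obtain ⟨u, hu, hux⟩ := mem_nbrs.1 hx
  exact mem_nbrs.2 ⟨u, h hu, hux⟩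

variable [DecidableEq V]

theorem nbrs_union (H : SimpleGraph V) (U W : Finset V) :
    nbrs H (U ∪ W) = nbrs H U ∪ nbrs H W := by
  ext x
  simp only [mem_nbrs, mem_union, or_and_right, exists_or]

/-- Any two disjoint sets of `m` vertices are joined by an edge. -/
def IsJoined (H : SimpleGraph V) (m : ℕ) : Prop :=
  ∀ A B : Finset V, Disjoint A B → A.card = m → B.card = m → ∃ a ∈ A, ∃ b ∈ B, H.Adj a b

theorem IsJoined.card_lt {H : SimpleGraph V} {m : ℕ} (hJ : IsJoined H m) {U : Finset V}
    (hU : m ≤ U.card) : Fintype.card V < U.card + (nbrs H U \ U).card + m := by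
  by_contra! h
  have h1 : m ≤ (univ \ (U ∪ (nbrs H U \ U))).card := by
    rw [card_sdiff_of_subset (subset_univ _), card_union_of_disjoint disjoint_sdiff, card_univ]
    omega
  obtain ⟨A, hA, hAm⟩ := exists_subset_card_eq hU
  obtain ⟨B, hB, hBm⟩ := exists_subset_card_eq h1
  have hBn : ∀ b ∈ B, b ∉ U ∧ b ∉ nbrs H U := by
    intro b hb
    have := hB hb
    simp only [Finset.mem_sdiff, mem_univ, true_and, mem_union, not_or, not_and, not_not] at this
    exact ⟨this.1, fun h => this.1 (this.2 h)⟩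
  obtain ⟨a, ha, b, hb, hab⟩ := hJ A B
    (disjoint_left.2 fun x hx hx' => (hBn x hx').1 (hA hx)) hAm hBm
  exact (hBn b hb).2 (mem_nbrs.2 ⟨a, hA ha, hab⟩)

/-- The set `S` of used vertices leaves room for giving `r x` new neighbours to every vertex `x`:
Hall's condition for the demands `r`, for sets of at most `2 * m` vertices. -/
def Extendable (H : SimpleGraph V) (m : ℕ) (S : Finset V) (r : V → ℕ) : Prop :=
  ∀ U : Finset V, U.card ≤ 2 * m → ∑ x ∈ U, r x ≤ (nbrs H U \ S).card

/-- In a joined graph a set `U` for which the condition of `Extendable` is an equality is small. -/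
theorem IsJoined.card_lt_of_tight {H : SimpleGraph V} {m D : ℕ} {S : Finset V} {r : V → ℕ}
    (hJ : IsJoined H m) (hr : ∀ x, r x ≤ D)
    (hS : S.card + (2 * D + 3) * m ≤ Fintype.card V) {U : Finset V} (hU : U.card ≤ 2 * m)
    (ht : (nbrs H U \ S).card = ∑ x ∈ U, r x) : U.card < m := by
  by_contra! h
  have h1 := hJ.card_lt h
  have h2 : ∑ x ∈ U, r x ≤ U.card * D := sum_le_card_nsmul _ _ _ fun x _ => hr x
  have h3 : U.card * D ≤ 2 * m * D := Nat.mul_le_mul_right _ hU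
  have h4 : (nbrs H U \ U).card ≤ (nbrs H U \ S).card + S.card := by
    calc (nbrs H U \ U).card ≤ ((nbrs H U \ S) ∪ S).card := card_le_card (by
          intro x hx
          by_cases hxS : x ∈ S
          · simp [hxS]
          · simp [hxS, (Finset.mem_sdiff.1 hx).1])
      _ ≤ _ := card_union_le _ _
  nlinarith

/-- One step of the embedding: a demand of `s` can be met by a neighbour `y` such that the new
configuration is extendable again. If no neighbour would do, then each is spoilt by a tight set;
tight sets are closed under union by submodularity, and adding `s` to the union of these sets
violates the condition. -/
theorem Extendable.exists_insert {H : SimpleGraph V} {m D : ℕ} {S : Finset V} {r : V → ℕ}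
    (hE : Extendable H m S r) (hJ : IsJoined H m) (hr : ∀ x, r x ≤ D)
    (hS : S.card + (2 * D + 3) * m ≤ Fintype.card V) {s : V} (hs : 0 < r s) :
    ∃ y, H.Adj s y ∧ y ∉ S ∧ Extendable H m (insert y S) (Function.update r s (r s - 1)) := by
  by_contra! hcon
  -- sums of the new demands
  have hsum : ∀ U : Finset V, ∑ x ∈ U, Function.update r s (r s - 1) x + (if s ∈ U then 1 else 0)
      = ∑ x ∈ U, r x := by
    intro U
    by_cases hsU : s ∈ U
    · rw [sum_update_of_mem hsU, if_pos hsU, ← add_sum_erase U r hsU, sdiff_singleton_eq_erase]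
      omega
    · rw [sum_update_of_notMem hsU, if_neg hsU, add_zero]
  have hY : ∀ y ∈ nbrs H {s} \ S, ∃ U : Finset V, U.card ≤ 2 * m ∧ s ∉ U ∧ y ∈ nbrs H U ∧
      (nbrs H U \ S).card = ∑ x ∈ U, r x := by
    intro y hy
    obtain ⟨hy1, hy2⟩ := Finset.mem_sdiff.1 hy
    have hsy : H.Adj s y := by simpa [mem_nbrs] using hy1
    have h := hcon y hsy hy2
    unfold Extendable at h
    push Not at h
    obtain ⟨U, hU, hlt⟩ := h
    have h1 := hE U hU
    have h2 := hsum U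
    have h3 : nbrs H U \ insert y S = (nbrs H U \ S).erase y := by
      ext x
      simp only [Finset.mem_sdiff, mem_insert, mem_erase]
      tauto
    rw [h3] at hlt
    by_cases hyU : y ∈ nbrs H U \ S
    · rw [card_erase_of_mem hyU] at hlt
      have := card_pos.2 ⟨y, hyU⟩
      by_cases hsU : s ∈ U
      · rw [if_pos hsU] at h2
        omega
      · rw [if_neg hsU] at h2
        exact ⟨U, hU, hsU, (Finset.mem_sdiff.1 hyU).1, by omega⟩
    · rw [erase_eq_of_notMem hyU] at hlt
      omega
  -- the union of the tight sets is tight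
  have hunion : ∀ Y ⊆ nbrs H {s} \ S, ∃ U : Finset V, U.card ≤ 2 * m ∧ s ∉ U ∧ Y ⊆ nbrs H U ∧
      (nbrs H U \ S).card = ∑ x ∈ U, r x := by
    intro Y
    induction Y using Finset.induction_on with
    | empty => exact fun _ => ⟨∅, by simp, by simp, by simp, by simp [nbrs]⟩
    | insert y Y _ ih =>
      intro hsub
      obtain ⟨U, hU, hsU, hYU, htU⟩ := ih ((subset_insert _ _).trans hsub)
      obtain ⟨W, hW, hsW, hyW, htW⟩ := hY y (hsub (mem_insert_self _ _))
      have hU' := hJ.card_lt_of_tight hr hS hU htU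
      have hW' := hJ.card_lt_of_tight hr hS hW htW
      have hcard : (U ∪ W).card ≤ 2 * m := (card_union_le _ _).trans (by omega)
      refine ⟨U ∪ W, hcard, by simp [hsU, hsW], ?_, ?_⟩
      · rw [nbrs_union]
        exact insert_subset (mem_union_right _ hyW) (hYU.trans subset_union_left)
      · have h1 := hE _ hcard
        have h2 := hE (U ∩ W) ((card_le_card inter_subset_left).trans hU)
        have h3 := sum_union_inter (s₁ := U) (s₂ := W) (f := r)
        have h4 := card_union_add_card_inter (nbrs H U \ S) (nbrs H W \ S)
        have h5 : nbrs H (U ∪ W) \ S = (nbrs H U \ S) ∪ (nbrs H W \ S) := by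
          rw [nbrs_union, union_sdiff_distrib]
        have h6 : (nbrs H (U ∩ W) \ S).card ≤ ((nbrs H U \ S) ∩ (nbrs H W \ S)).card := by
          refine card_le_card fun x hx => ?_
          have hx' := Finset.mem_sdiff.1 hx
          exact mem_inter.2 ⟨Finset.mem_sdiff.2 ⟨nbrs_mono H inter_subset_left hx'.1, hx'.2⟩,
            Finset.mem_sdiff.2 ⟨nbrs_mono H inter_subset_right hx'.1, hx'.2⟩⟩
        rw [h5] at h1 ⊢
        omega
  obtain ⟨U, hU, hsU, hYU, htU⟩ := hunion _ subset_rfl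
  have hU' := hJ.card_lt_of_tight hr hS hU htU
  have h1 := hE (insert s U) ((card_insert_le _ _).trans (by omega))
  have h2 : nbrs H (insert s U) \ S = nbrs H U \ S := by
    rw [insert_eq, nbrs_union, union_sdiff_distrib]
    exact union_eq_right.2 fun x hx => Finset.mem_sdiff.2 ⟨hYU hx, (Finset.mem_sdiff.1 hx).2⟩
  rw [h2, sum_insert hsU] at h1
  omega

/-- A joined graph has expansion outside of a small set `B`: a largest set that does not expand. -/
theorem IsJoined.exists_extendable {H : SimpleGraph V} {m D : ℕ} (hJ : IsJoined H m)
    (hm : 1 ≤ m) (hV : (2 * D + 4) * m ≤ Fintype.card V) :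
    ∃ B : Finset V, B.card < m ∧ Extendable H m B fun x => if x ∈ B then 0 else D := by
  have hnil : nbrs H ∅ = ∅ := by simp [nbrs]
  obtain ⟨B, hB, hmax⟩ := exists_max_image
    (univ.filter fun B : Finset V => B.card ≤ 2 * m ∧ (nbrs H B \ B).card ≤ D * B.card)
    Finset.card ⟨∅, by simp [hnil]⟩
  simp only [mem_filter, mem_univ, true_and, and_imp] at hB hmax
  have hBm : B.card < m := by
    by_contra! h
    have := hJ.card_lt h
    nlinarith
  refine ⟨B, hBm, fun U hU => ?_⟩
  set W := U \ B with hW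
  have hsum : ∑ x ∈ U, (if x ∈ B then 0 else D) = D * W.card := by
    rw [← sum_sdiff (inter_subset_left (s₁ := U) (s₂ := B)), sdiff_inter_self_left,
      sum_congr rfl (g := fun _ => D) (by intro x hx; rw [if_neg (Finset.mem_sdiff.1 hx).2]),
      sum_eq_zero (s := U ∩ B) (by intro x hx; rw [if_pos (mem_inter.1 hx).2])]
    simp [hW, mul_comm]
  rw [hsum]
  refine le_trans ?_ (card_le_card (sdiff_subset_sdiff (nbrs_mono H (sdiff_subset : W ⊆ U))
    subset_rfl))
  have hWU : W.card ≤ 2 * m := (card_le_card sdiff_subset).trans hU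
  by_contra! hlt
  have hdisj : Disjoint B W := disjoint_sdiff
  have hBW : (B ∪ W).card = B.card + W.card := card_union_of_disjoint hdisj
  have hWpos : 0 < W.card := by
    by_contra! h
    have : W.card = 0 := by omega
    simp [this] at hlt
  by_cases hc : (B ∪ W).card ≤ 2 * m
  · have h1 : (nbrs H (B ∪ W) \ (B ∪ W)).card ≤ D * (B ∪ W).card := by
      calc (nbrs H (B ∪ W) \ (B ∪ W)).card ≤ ((nbrs H B \ B) ∪ (nbrs H W \ B)).card := by
            refine card_le_card fun x hx => ?_
            simp only [nbrs_union, Finset.mem_sdiff, mem_union, not_or] at hx ⊢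
            tauto
        _ ≤ (nbrs H B \ B).card + (nbrs H W \ B).card := card_union_le _ _
        _ ≤ _ := by rw [hBW]; nlinarith [hB.2]
    have h2 := hmax _ hc h1
    omega
  · have h1 := hJ.card_lt (U := W) (by omega)
    have h2 : (nbrs H W \ W).card ≤ (nbrs H W \ B).card + B.card := by
      calc (nbrs H W \ W).card ≤ ((nbrs H W \ B) ∪ B).card := card_le_card (by
            intro x hx
            by_cases hxS : x ∈ B
            · simp [hxS]
            · simp [hxS, (Finset.mem_sdiff.1 hx).1])
        _ ≤ _ := card_union_le _ _
    nlinarith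

/-- Every subtree of suitable size of a tree of maximum degree at most `Δ`, grown from the root in
some order, embeds into a joined graph. -/
theorem IsJoined.exists_embedding {T H : SimpleGraph V} (ρ : Rooting T) {m Δ : ℕ}
    (hJ : IsJoined H m) (hm : 1 ≤ m)
    (hΔ : ∀ v, (univ.filter fun w => T.Adj v w).card ≤ Δ) {k : ℕ} (hk : 1 ≤ k)
    (hkV : k + (2 * Δ + 6) * m ≤ Fintype.card V) :
    ∃ A : Finset V, ρ.IsClosed A ∧ A.card = k ∧ ∃ φ : V → V, Set.InjOn φ A ∧
      ∀ v ∈ A, v ≠ ρ.root → H.Adj (φ (ρ.parent v)) (φ v) := by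
  obtain ⟨B, hBm, hB⟩ := hJ.exists_extendable (D := Δ + 1) hm (by nlinarith)
  obtain ⟨x₀, hx₀⟩ : ∃ x, x ∉ B := by
    by_contra! h
    have := card_univ (α := V) ▸ congrArg Finset.card (eq_univ_iff_forall.2 h)
    nlinarith
  suffices h : ∀ j, 1 ≤ j → j ≤ k → ∃ A : Finset V, ρ.IsClosed A ∧ A.card = j ∧ ∃ φ : V → V,
      Set.InjOn φ A ∧ (∀ v ∈ A, v ≠ ρ.root → H.Adj (φ (ρ.parent v)) (φ v)) ∧ ∃ r : V → ℕ,
      Extendable H m (B ∪ A.image φ) r ∧ (∀ x, r x ≤ Δ) ∧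
      (∀ a ∈ A, (univ.filter fun c => (c ≠ ρ.root ∧ ρ.parent c = a) ∧ c ∉ A).card ≤ r (φ a)) ∧
      ∀ x, x ∉ B ∪ A.image φ → r x = Δ by
    obtain ⟨A, h1, h2, φ, h3, h4, -⟩ := h k hk le_rfl
    exact ⟨A, h1, h2, φ, h3, h4⟩
  have hch : ∀ (A : Finset V) a,
      (univ.filter fun c => (c ≠ ρ.root ∧ ρ.parent c = a) ∧ c ∉ A).card ≤ Δ := by
    intro A a
    refine (card_le_card fun c hc => ?_).trans (hΔ a)
    simp only [mem_filter, mem_univ, true_and] at hc ⊢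
    exact hc.1.2 ▸ Rooting.adj_parent hc.1.1
  intro j hj
  induction j, hj using Nat.le_induction with
  | base =>
    intro _
    refine ⟨{ρ.root}, ⟨by simp, by simp⟩, by simp, fun _ => x₀, by simp, by simp,
      fun x => if x ∈ B then 0 else Δ, ?_, ?_, ?_, ?_⟩
    · -- one unit of expansion pays for the image of the root
      intro U hU
      have h1 : ∑ x ∈ U, (if x ∈ B then 0 else Δ + 1) ≤ (nbrs H U \ B).card := hB U hU
      change ∑ x ∈ U, (if x ∈ B then 0 else Δ) ≤ _
      have h2 : nbrs H U \ (B ∪ image (fun _ => x₀) {ρ.root}) = (nbrs H U \ B).erase x₀ := by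
        ext x
        simp only [image_singleton, Finset.mem_sdiff, mem_union, mem_singleton, mem_erase]
        tauto
      rw [h2]
      have h3 := pred_card_le_card_erase (s := nbrs H U \ B) (a := x₀)
      by_cases hz : ∀ x ∈ U, x ∈ B
      · rw [sum_eq_zero fun x hx => if_pos (hz x hx)]
        exact Nat.zero_le _
      · push Not at hz
        obtain ⟨x, hx, hxB⟩ := hz
        have : ∑ x ∈ U, (if x ∈ B then 0 else Δ) < ∑ x ∈ U, (if x ∈ B then 0 else Δ + 1) :=
          sum_lt_sum (fun i _ => by split_ifs <;> omega) ⟨x, hx, by simp [hxB]⟩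
        omega
    · intro x
      dsimp only
      split_ifs <;> omega
    · intro a _
      simp only [if_neg hx₀]
      exact hch _ a
    · intro x hx
      simp only [mem_union, not_or] at hx
      simp [hx.1]
  | succ j hj ih =>
    intro hjk
    obtain ⟨A, hA, hAj, φ, hinj, hadj, r, hE, hrΔ, hrA, hrS⟩ := ih (by omega)
    have hlt : A ≠ univ := by
      rintro rfl
      rw [card_univ] at hAj
      omega
    obtain ⟨v, hvA, hvr, hpA, hcl⟩ := hA.exists_insert hlt
    have hpos : 0 < r (φ (ρ.parent v)) :=
      lt_of_lt_of_le (card_pos.2 ⟨v, by simp [hvr, hvA]⟩) (hrA _ hpA)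
    have hScard : (B ∪ A.image φ).card ≤ m + j :=
      (card_union_le _ _).trans (by have := card_image_le (s := A) (f := φ); omega)
    obtain ⟨y, hy, hyS, hE'⟩ := hE.exists_insert hJ hrΔ (by nlinarith) hpos
    have hyA : ∀ a ∈ A, φ a ≠ y := fun a ha h =>
      hyS (mem_union_right _ (mem_image.2 ⟨a, ha, h⟩))
    have hne : ∀ a ∈ A, a ≠ v := fun a ha h => hvA (h ▸ ha)
    have hφ : ∀ a ∈ A, Function.update φ v y a = φ a := fun a ha =>
      Function.update_of_ne (hne a ha) _ _
    have himg : B ∪ (insert v A).image (Function.update φ v y) = insert y (B ∪ A.image φ) := by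
      rw [image_insert, Function.update_self, union_insert,
        image_congr (g := φ) fun a ha => hφ a ha]
    refine ⟨insert v A, hcl, by rw [card_insert_of_notMem hvA, hAj], Function.update φ v y, ?_, ?_,
      Function.update r (φ (ρ.parent v)) (r (φ (ρ.parent v)) - 1), himg ▸ hE', ?_, ?_, ?_⟩
    · rw [coe_insert, Set.injOn_insert (by simpa using hvA)]
      refine ⟨fun a ha b hb h => hinj ha hb ?_, ?_⟩
      · rwa [hφ a ha, hφ b hb] at h
      · rintro ⟨a, ha, h⟩
        rw [hφ a ha, Function.update_self] at h
        exact hyA a ha h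
    · intro a ha har
      rcases mem_insert.1 ha with rfl | ha
      · rwa [Function.update_self, hφ _ hpA]
      · rw [hφ a ha, hφ _ (hA.2 a ha har)]
        exact hadj a ha har
    · intro x
      by_cases hx : x = φ (ρ.parent v)
      · subst hx
        rw [Function.update_self]
        exact (Nat.sub_le _ _).trans (hrΔ _)
      · rw [Function.update_of_ne hx]
        exact hrΔ x
    · intro a ha
      rcases mem_insert.1 ha with rfl | ha
      · rw [Function.update_self, Function.update_of_ne (hyA _ hpA).symm, hrS y hyS]
        exact hch _ _
      · rw [hφ a ha]
        by_cases hap : a = ρ.parent v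
        · subst hap
          rw [Function.update_self]
          refine Nat.le_sub_one_of_lt (lt_of_lt_of_le (card_lt_card ?_) (hrA _ ha))
          refine ⟨fun c hc => ?_, fun h => ?_⟩
          · simp only [mem_filter, mem_univ, true_and, mem_insert, not_or] at hc ⊢
            tauto
          · have := @h v (by simp [hvr, hvA])
            simp at this
        · rw [Function.update_of_ne fun h => hap (hinj ha hpA h)]
          refine (card_le_card fun c hc => ?_).trans (hrA a ha)
          simp only [mem_filter, mem_univ, true_and, mem_insert, not_or] at hc ⊢
          tauto
    · intro x hx
      rw [himg, mem_insert, not_or] at hx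
      rw [Function.update_of_ne, hrS x hx.2]
      rintro rfl
      exact hx.2 (mem_union_right _ (mem_image_of_mem _ hpA))

end Joined

/-! ### Absorption -/

section Absorption

variable {V : Type*} [Fintype V] [DecidableEq V]

/-- The tree vertices `s` whose image under `φ` is a neighbour of `x` and the images of whose
neighbours are all neighbours of `u`. In an embedded tree, `u` can take over the place of such a
vertex, and its old place becomes available for a new leaf attached at `x`. -/
noncomputable def absorbers (G T : SimpleGraph V) (φ : V → V) (x u : V) : Finset V :=
  univ.filter fun s => G.Adj x (φ s) ∧ ∀ t, T.Adj s t → G.Adj u (φ t)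

/-- If a bijection `φ` embeds a large subtree of `T` into `H` and there are many absorbers for all
pairs of vertices, then `G ⊔ H` contains `T`. The remaining vertices are added one at a time. -/
theorem isContained_sup_of_absorbers {G H T : SimpleGraph V} (ρ : Rooting T) {Δ L : ℕ}
    (hΔ : ∀ v, (univ.filter fun w => T.Adj v w).card ≤ Δ) {A : Finset V} (hA : ρ.IsClosed A)
    (hAL : Fintype.card V ≤ A.card + L) (φ : Equiv.Perm V)
    (hφ : ∀ v ∈ A, v ≠ ρ.root → H.Adj (φ (ρ.parent v)) (φ v))
    (habs : ∀ x u, (Δ + 3) * L < (absorbers G T φ x u).card) : T ⊑ G ⊔ H := by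
  suffices h : ∀ j, A.card + j ≤ Fintype.card V → ∃ A' : Finset V, ρ.IsClosed A' ∧
      A'.card = A.card + j ∧ ∃ ψ : V → V, Set.InjOn ψ A' ∧
      (∀ v ∈ A', v ≠ ρ.root → (G ⊔ H).Adj (ψ (ρ.parent v)) (ψ v)) ∧
      ∃ Z : Finset V, Z.card ≤ (Δ + 2) * j ∧ ∀ s ∈ A, s ∉ Z → s ∈ A' ∧ ψ s = φ s ∧
        ∀ t ∈ A', T.Adj s t → ψ t = φ t by
    obtain ⟨A', hA', hcard, ψ, hinj, hadj, -⟩ := h (Fintype.card V - A.card) (by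
      have := card_le_univ A
      omega)
    have huniv : A' = univ := by
      rw [← card_eq_iff_eq_univ]
      have := card_le_univ A
      omega
    subst huniv
    refine ⟨⟨⟨ψ, fun {u v} huv => ?_⟩, fun a b h => hinj (by simp) (by simp) h⟩⟩
    rcases (ρ.adj_iff u v).1 huv with ⟨h, rfl⟩ | ⟨h, rfl⟩
    · exact (hadj u (mem_univ _) h).symm
    · exact hadj v (mem_univ _) h
  intro j
  induction j with
  | zero =>
    exact fun _ => ⟨A, hA, rfl, φ, φ.injective.injOn, fun v hv hr => Or.inr (hφ v hv hr), ∅,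
      by simp, fun s hs _ => ⟨hs, rfl, fun _ _ _ => rfl⟩⟩
  | succ j ih =>
    intro hj
    obtain ⟨A', hA', hcard, ψ, hinj, hadj, Z, hZ, hgood⟩ := ih (by omega)
    have hlt : A' ≠ univ := by
      rintro rfl
      rw [card_univ] at hcard
      omega
    obtain ⟨v, hvA, hvr, hpA, hcl⟩ := hA'.exists_insert hlt
    obtain ⟨u, hu⟩ : ∃ u, u ∉ A'.image ψ := by
      by_contra! h
      have h1 := congrArg Finset.card (eq_univ_iff_forall.2 h)
      have h2 := card_image_le (s := A') (f := ψ)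
      rw [card_univ] at h1
      omega
    have huA : ∀ a ∈ A', ψ a ≠ u := fun a ha h => hu (mem_image.2 ⟨a, ha, h⟩)
    -- an absorber in the original subtree that no earlier step has touched
    obtain ⟨s, hsW, hsA, hsZ⟩ :
        ∃ s ∈ absorbers G T φ (ψ (ρ.parent v)) u, s ∈ A ∧ s ∉ Z := by
      by_contra! h
      have h1 : absorbers G T φ (ψ (ρ.parent v)) u ⊆ Z ∪ (univ \ A) := by
        intro s hs
        by_cases hsA : s ∈ A
        · exact mem_union_left _ (h s hs hsA)
        · exact mem_union_right _ (by simp [hsA])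
      have h2 := (card_le_card h1).trans (card_union_le _ _)
      rw [card_sdiff_of_subset (subset_univ _), card_univ] at h2
      have h3 := habs (ψ (ρ.parent v)) u
      have h4 : (Δ + 2) * j ≤ (Δ + 2) * L := Nat.mul_le_mul_left _ (by omega)
      have h5 : (Δ + 3) * L = (Δ + 2) * L + L := by ring
      omega
    obtain ⟨hsA', hsφ, hsn⟩ := hgood s hsA hsZ
    simp only [absorbers, mem_filter, mem_univ, true_and] at hsW
    obtain ⟨hsx, hsu⟩ := hsW
    have hsv : s ≠ v := fun h => hvA (h ▸ hsA')
    have hps : ρ.parent v ≠ s := by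
      intro h
      rw [h, hsφ] at hsx
      exact G.irrefl hsx
    have hne : ∀ a ∈ A', a ≠ v := fun a ha h => hvA (h ▸ ha)
    set ψ' := Function.update (Function.update ψ s u) v (φ s) with hψ'
    have hv' : ψ' v = φ s := Function.update_self ..
    have hs' : ψ' s = u := by rw [hψ', Function.update_of_ne hsv, Function.update_self]
    have ho : ∀ a ∈ A', a ≠ s → ψ' a = ψ a := fun a ha has => by
      rw [hψ', Function.update_of_ne (hne a ha), Function.update_of_ne has]
    refine ⟨insert v A', hcl, by rw [card_insert_of_notMem hvA, hcard]; ring, ψ', ?_, ?_,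
      Z ∪ insert (ρ.parent v) (insert s (univ.filter fun w => T.Adj s w)), ?_, ?_⟩
    · rw [coe_insert, Set.injOn_insert (by simpa using hvA)]
      refine ⟨fun a ha b hb h => ?_, ?_⟩
      · by_cases has : a = s <;> by_cases hbs : b = s
        · rw [has, hbs]
        · rw [has, hs', ho b hb hbs] at h
          exact absurd h.symm (huA b hb)
        · rw [hbs, hs', ho a ha has] at h
          exact absurd h (huA a ha)
        · rw [ho a ha has, ho b hb hbs] at h
          exact hinj ha hb h
      · rintro ⟨a, ha, h⟩
        rw [hv'] at h
        by_cases has : a = s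
        · rw [has, hs'] at h
          exact huA s hsA' (hsφ.trans h.symm)
        · rw [ho a ha has, ← hsφ] at h
          exact has (hinj ha hsA' h)
    · intro a ha har
      rcases mem_insert.1 ha with rfl | ha
      · rw [hv', ho _ hpA hps]
        exact Or.inl hsx
      · by_cases has : a = s
        · subst has
          have hadj' := (Rooting.adj_parent har : T.Adj (ρ.parent a) a).symm
          have hpa := hA'.2 a ha har
          rw [hs', ho _ hpa hadj'.ne.symm, hsn _ hpa hadj']
          exact Or.inl (hsu _ hadj').symm
        · rw [ho a ha has]
          by_cases hpas : ρ.parent a = s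
          · have hadj' : T.Adj s a := hpas ▸ Rooting.adj_parent har
            rw [hpas, hs', hsn _ ha hadj']
            exact Or.inl (hsu _ hadj')
          · rw [ho _ (hA'.2 a ha har) hpas]
            exact hadj a ha har
    · have h1 := card_union_le Z (insert (ρ.parent v) (insert s (univ.filter fun w => T.Adj s w)))
      have h2 := card_insert_le (ρ.parent v) (insert s (univ.filter fun w => T.Adj s w))
      have h3 := card_insert_le s (univ.filter fun w => T.Adj s w)
      have h4 := hΔ s
      rw [Nat.mul_succ]
      omega
    · intro b hb hbZ
      simp only [mem_union, mem_insert, mem_filter, mem_univ, true_and, not_or] at hbZ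
      obtain ⟨hbZ, hbp, hbs, hbn⟩ := hbZ
      obtain ⟨hbA', hbφ, hbt⟩ := hgood b hb hbZ
      refine ⟨mem_insert_of_mem hbA', by rw [ho b hbA' hbs, hbφ], fun t ht hadj' => ?_⟩
      rcases mem_insert.1 ht with rfl | ht
      · exact absurd (hA'.eq_parent_of_adj hvA hbA' hadj'.symm) hbp
      · rw [ho t ht, hbt t ht hadj']
        rintro rfl
        exact hbn hadj'.symm

end Absorption

/-! ### Random permutations and random functions -/

theorem factorial_mul_exp_le (k : ℕ) :
    (k.factorial : ℝ) * Real.exp k ≤ Real.exp 1 * (k + 1) * (k : ℝ) ^ k := by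
  -- the induction needs the slightly stronger bound with factor `k`
  suffices h : ∀ k : ℕ, 1 ≤ k →
      (k.factorial : ℝ) * Real.exp k ≤ Real.exp 1 * k * (k : ℝ) ^ k by
    rcases Nat.eq_zero_or_pos k with rfl | hk
    · simp
    · refine (h k hk).trans ?_
      gcongr
      linarith
  intro k hk
  induction k, hk using Nat.le_induction with
  | base => simp
  | succ k hk ih =>
    have hk0 : (0 : ℝ) < k := by exact_mod_cast hk
    have h1 : Real.exp 1 * (k : ℝ) ^ (k + 1) ≤ ((k : ℝ) + 1) ^ (k + 1) := by
      have h2 := Real.one_sub_inv_le_log_of_pos (x := ((k : ℝ) + 1) / k) (by positivity)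
      have h3 : 1 ≤ ((k + 1 : ℕ) : ℝ) * Real.log (((k : ℝ) + 1) / k) := by
        have : 1 - (((k : ℝ) + 1) / k)⁻¹ = 1 / ((k : ℝ) + 1) := by
          field_simp
          ring
        rw [this] at h2
        push_cast
        calc (1 : ℝ) = ((k : ℝ) + 1) * (1 / ((k : ℝ) + 1)) := by field_simp
          _ ≤ _ := by gcongr
      have h4 := Real.exp_le_exp.2 h3
      rw [Real.exp_nat_mul, Real.exp_log (by positivity), div_pow,
        le_div_iff₀ (by positivity)] at h4
      exact h4
    rw [Nat.factorial_succ]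
    push_cast
    rw [Real.exp_add]
    calc ((k : ℝ) + 1) * k.factorial * (Real.exp k * Real.exp 1)
        = ((k : ℝ) + 1) * Real.exp 1 * (k.factorial * Real.exp k) := by ring
      _ ≤ ((k : ℝ) + 1) * Real.exp 1 * (Real.exp 1 * k * (k : ℝ) ^ k) := by gcongr
      _ = ((k : ℝ) + 1) * Real.exp 1 * (Real.exp 1 * (k : ℝ) ^ (k + 1)) := by ring
      _ ≤ ((k : ℝ) + 1) * Real.exp 1 * ((k : ℝ) + 1) ^ (k + 1) := by gcongr
      _ = _ := by ring

section Perm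

variable {V κ : Type*} [Fintype V] [DecidableEq V] [Fintype κ] [DecidableEq κ]

/-- If the class sizes of the colouring `c` are `k j`, then there are `∏ j, k j !` permutations and
`∏ j, k j ^ k j` functions that pull back `c` to a given colouring with these class sizes. -/
theorem card_perm_comp_eq_mul_le (c τ : V → κ) :
    ((univ.filter fun σ : Equiv.Perm V => c ∘ σ = τ).card : ℝ) *
        (Fintype.card V : ℝ) ^ Fintype.card V ≤
      (Real.exp 1 * (Fintype.card V + 1)) ^ Fintype.card κ *
        (univ.filter fun f : V → V => c ∘ f = τ).card * (Fintype.card V).factorial := by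
  by_cases hσ : ∃ σ₀ : Equiv.Perm V, c ∘ σ₀ = τ
  swap
  · rw [filter_false_of_mem fun σ _ h => hσ ⟨σ, h⟩, card_empty]
    simp only [Nat.cast_zero, zero_mul]
    positivity
  obtain ⟨σ₀, rfl⟩ := hσ
  set k : κ → ℕ := fun j => (univ.filter fun v => c v = j).card with hk
  have hσ : (univ.filter fun σ : Equiv.Perm V => c ∘ σ = c ∘ σ₀).card = ∏ j, (k j).factorial := by
    have h1 := DomMulAct.stabilizer_card c
    simp only [Fintype.card_subtype] at h1
    rw [← h1]
    refine card_bij (fun σ _ => σ * σ₀⁻¹) ?_ ?_ ?_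
    · intro σ h
      simp only [mem_filter, mem_univ, true_and] at h ⊢
      ext v
      simpa using congrFun h (σ₀⁻¹ v)
    · intro σ _ σ' _ h
      exact mul_right_cancel h
    · intro σ h
      simp only [mem_filter, mem_univ, true_and] at h
      refine ⟨σ * σ₀, ?_, by simp⟩
      simp only [mem_filter, mem_univ, true_and]
      ext v
      simpa using congrFun h (σ₀ v)
  have hf : (univ.filter fun f : V → V => c ∘ f = c ∘ σ₀).card = ∏ j, k j ^ k j := by
    have h1 : (univ.filter fun f : V → V => c ∘ f = c ∘ σ₀) =
        Fintype.piFinset fun v => univ.filter fun w => c w = c (σ₀ v) := by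
      ext f
      simp [funext_iff]
    rw [h1, Fintype.card_piFinset]
    change ∏ v, k (c (σ₀ v)) = _
    rw [Equiv.prod_comp σ₀ fun v => k (c v), prod_comp k c,
      ← prod_subset (subset_univ (univ.image c))]
    intro j _ hj
    have : k j = 0 := by
      rw [hk, card_eq_zero]
      refine filter_false_of_mem fun v _ h => hj (mem_image.2 ⟨v, mem_univ _, h⟩)
    simp [this]
  have hksum : ∑ j, k j = Fintype.card V := by
    have := card_eq_sum_card_fiberwise (f := c) (s := univ) (t := univ) (by simp)
    rw [← card_univ, this]
  have hkle : ∀ j, k j ≤ Fintype.card V := fun j => card_le_univ _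
  rw [hσ, hf]
  push_cast
  -- compare both sides with powers of `e`
  have h1 : (∏ j, ((k j).factorial : ℝ)) * Real.exp (Fintype.card V) ≤
      (Real.exp 1 * (Fintype.card V + 1)) ^ Fintype.card κ * ∏ j, (k j : ℝ) ^ k j := by
    rw [← hksum]
    push_cast
    rw [Real.exp_sum, ← prod_mul_distrib, ← card_univ, ← prod_const, ← prod_mul_distrib]
    refine prod_le_prod (fun _ _ => by positivity) fun j _ => ?_
    refine (factorial_mul_exp_le (k j)).trans ?_
    have : (k j : ℝ) ≤ ∑ j, (k j : ℝ) := by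
      exact_mod_cast hksum ▸ hkle j
    gcongr
  have h2 : (Fintype.card V : ℝ) ^ Fintype.card V ≤
      Real.exp (Fintype.card V) * (Fintype.card V).factorial := by
    have := Real.pow_div_factorial_le_exp (Fintype.card V : ℝ) (by positivity) (Fintype.card V)
    rwa [div_le_iff₀ (by positivity)] at this
  calc (∏ j, ((k j).factorial : ℝ)) * (Fintype.card V : ℝ) ^ Fintype.card V
      ≤ (∏ j, ((k j).factorial : ℝ)) *
        (Real.exp (Fintype.card V) * (Fintype.card V).factorial) := by gcongr
    _ = (∏ j, ((k j).factorial : ℝ)) * Real.exp (Fintype.card V) * (Fintype.card V).factorial := by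
        ring
    _ ≤ _ := by gcongr

/-- An event about the colours that a random permutation gives to the points is at most
polynomially more likely than for a random function, whose values are independent: the permutation
is a function conditioned on the most likely colour counts. -/
theorem card_perm_comp_mem_mul_le (c : V → κ) (S : Set (V → κ)) :
    ((univ.filter fun σ : Equiv.Perm V => c ∘ σ ∈ S).card : ℝ) *
        (Fintype.card V : ℝ) ^ Fintype.card V ≤
      (Real.exp 1 * (Fintype.card V + 1)) ^ Fintype.card κ *
        (univ.filter fun f : V → V => c ∘ f ∈ S).card * (Fintype.card V).factorial := by
  have h1 : (univ.filter fun σ : Equiv.Perm V => c ∘ σ ∈ S).card =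
      ∑ τ ∈ univ.filter (· ∈ S), (univ.filter fun σ : Equiv.Perm V => c ∘ σ = τ).card := by
    rw [card_eq_sum_card_fiberwise (f := fun σ : Equiv.Perm V => c ∘ σ) (t := univ.filter (· ∈ S))
      (fun σ hσ => by simpa using hσ)]
    refine sum_congr rfl fun τ hτ => congrArg _ ?_
    ext σ
    simp only [mem_filter, mem_univ, true_and] at hτ ⊢
    exact ⟨fun h => h.2, fun h => ⟨h ▸ hτ, h⟩⟩
  have h2 : (univ.filter fun f : V → V => c ∘ f ∈ S).card =
      ∑ τ ∈ univ.filter (· ∈ S), (univ.filter fun f : V → V => c ∘ f = τ).card := by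
    rw [card_eq_sum_card_fiberwise (f := fun f : V → V => c ∘ f) (t := univ.filter (· ∈ S))
      (fun σ hσ => by simpa using hσ)]
    refine sum_congr rfl fun τ hτ => congrArg _ ?_
    ext σ
    simp only [mem_filter, mem_univ, true_and] at hτ ⊢
    exact ⟨fun h => h.2, fun h => ⟨h ▸ hτ, h⟩⟩
  rw [h1, h2]
  push_cast
  rw [sum_mul, mul_sum, sum_mul]
  exact sum_le_sum fun τ _ => card_perm_comp_eq_mul_le c τ

end Perm

section Functions

variable {V : Type*} [Fintype V] [DecidableEq V]

/-- Functions of disjoint sets of coordinates of a uniformly random function are uncorrelated: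
exchanging the values on `S` is an involution on pairs of functions. -/
theorem sum_mul_sum_eq_of_disjoint_support (S : Finset V) (F g : (V → V) → ℝ)
    (hF : ∀ f f', (∀ v, v ∉ S → f v = f' v) → F f = F f')
    (hg : ∀ f f', (∀ v ∈ S, f v = f' v) → g f = g f') :
    (∑ f, F f) * ∑ f, g f = (Fintype.card V : ℝ) ^ Fintype.card V * ∑ f, F f * g f := by
  have h1 : (∑ f, F f) * ∑ f, g f = ∑ q : (V → V) × (V → V), F q.1 * g q.2 := by
    rw [sum_mul_sum, Fintype.sum_prod_type]
  have h2 : ∑ q : (V → V) × (V → V), F q.1 * g q.2 =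
      ∑ q : (V → V) × (V → V), F q.1 * g q.1 := by
    let e : (V → V) × (V → V) → (V → V) × (V → V) :=
      fun q => (S.piecewise q.2 q.1, S.piecewise q.1 q.2)
    have he : Function.Involutive e := by
      rintro ⟨a, b⟩
      ext v <;> by_cases hv : v ∈ S <;> simp [e, hv]
    rw [← Equiv.sum_comp (he.toPerm e)]
    refine sum_congr rfl fun q _ => ?_
    have h3 : F (e q).1 = F q.1 := hF _ _ fun v hv => by simp [e, hv]
    have h4 : g (e q).2 = g q.1 := hg _ _ fun v hv => by simp [e, hv]
    change F (e q).1 * g (e q).2 = _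
    rw [h3, h4]
  rw [h1, h2, Fintype.sum_prod_type]
  simp [mul_sum]

/-- A lower tail bound for the number of events that occur, for events `E s` that depend on
disjoint sets of coordinates of a random function and have probability at least `p`. -/
theorem card_filter_card_lt_le {I : Finset V} {St : V → Finset V}
    (hdisj : ∀ s ∈ I, ∀ t ∈ I, s ≠ t → Disjoint (St s) (St t)) {E : V → (V → V) → Prop}
    (hE : ∀ s f f', (∀ v ∈ St s, f v = f' v) → (E s f ↔ E s f')) {p : ℝ} (hp : p ≤ 1)
    (hEp : ∀ s, p * (Fintype.card V : ℝ) ^ Fintype.card V ≤ (univ.filter fun f => E s f).card)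
    (K : ℕ) :
    ((univ.filter fun f : V → V => (I.filter fun s => E s f).card < K).card : ℝ) ≤
      2 ^ K * Real.exp (-(p * I.card / 2)) * (Fintype.card V : ℝ) ^ Fintype.card V := by
  set N : ℝ := (Fintype.card V : ℝ) ^ Fintype.card V with hN
  have hNpos : 0 < N := by
    rw [hN]
    rcases Nat.eq_zero_or_pos (Fintype.card V) with h | h
    · simp [h]
    · positivity
  have hcardN : ((univ : Finset (V → V)).card : ℝ) = N := by
    rw [card_univ, Fintype.card_fun, hN]
    push_cast
    rfl
  -- the expectation of `2 ^ (-X)`, where `X` is the number of events that occur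
  set w : V → (V → V) → ℝ := fun s f => if E s f then 1 / 2 else 1 with hw
  have hw1 : ∀ s, ∑ f, w s f ≤ (1 - p / 2) * N := by
    intro s
    have h1 : ∀ f, w s f = 1 - (1 / 2) * (if E s f then 1 else 0) := by
      intro f
      simp only [hw]
      split_ifs <;> norm_num
    rw [sum_congr rfl fun f _ => h1 f, sum_sub_distrib, ← mul_sum, sum_boole]
    simp only [sum_const, nsmul_eq_mul, mul_one]
    rw [hcardN]
    linarith [hEp s]
  have hprod : ∀ J ⊆ I, ∑ f, ∏ s ∈ J, w s f ≤ (1 - p / 2) ^ J.card * N := by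
    intro J
    induction J using Finset.induction_on with
    | empty =>
      intro _
      simp [hN]
    | insert s J hs ih =>
      intro hJ
      have h1 := sum_mul_sum_eq_of_disjoint_support (St s) (fun f => ∏ t ∈ J, w t f) (w s)
        (fun f f' h => prod_congr rfl fun t ht => by
          have hd := hdisj t (hJ (mem_insert_of_mem ht)) s (hJ (mem_insert_self _ _))
            (fun h => hs (h ▸ ht))
          have := hE t f f' fun v hv => h v (disjoint_left.1 hd hv)
          simp only [hw, this])
        (fun f f' h => by
          have := hE s f f' h
          simp only [hw, this])
      have h2 := ih ((subset_insert _ _).trans hJ)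
      have h3 : ∀ f, ∏ t ∈ insert s J, w t f = (∏ t ∈ J, w t f) * w s f := fun f => by
        rw [prod_insert hs, mul_comm]
      rw [sum_congr rfl fun f _ => h3 f, card_insert_of_notMem hs, pow_succ]
      refine le_of_mul_le_mul_left ?_ hNpos
      rw [← h1]
      have h4 : (0 : ℝ) ≤ ∑ f, w s f := sum_nonneg fun f _ => by
        simp only [hw]
        split_ifs <;> norm_num
      calc (∑ f, ∏ t ∈ J, w t f) * ∑ f, w s f
          ≤ ((1 - p / 2) ^ J.card * N) * ((1 - p / 2) * N) := by
            refine mul_le_mul h2 (hw1 s) h4 ?_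
            have : 0 ≤ 1 - p / 2 := by linarith
            positivity
        _ = _ := by ring
  have hmarkov : ((univ.filter fun f : V → V => (I.filter fun s => E s f).card < K).card : ℝ) *
      (1 / 2) ^ K ≤ ∑ f, ∏ s ∈ I, w s f := by
    rw [← nsmul_eq_mul, ← sum_const]
    refine (sum_le_sum fun f hf => ?_).trans (sum_le_sum_of_subset_of_nonneg
      (f := fun f => ∏ s ∈ I, w s f) (subset_univ _) fun f _ _ => prod_nonneg fun s _ => ?_)
    · simp only [mem_filter, mem_univ, true_and] at hf
      simp only [hw]
      rw [prod_ite, prod_const, prod_const_one, mul_one]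
      exact pow_le_pow_of_le_one (by norm_num) (by norm_num) hf.le
    · simp only [hw]
      split_ifs <;> norm_num
  have hexp : (1 - p / 2) ^ I.card ≤ Real.exp (-(p * I.card / 2)) := by
    have h1 : 1 - p / 2 ≤ Real.exp (-(p / 2)) := by
      have := Real.add_one_le_exp (-(p / 2))
      linarith
    calc (1 - p / 2) ^ I.card ≤ Real.exp (-(p / 2)) ^ I.card :=
          pow_le_pow_left₀ (by linarith) h1 _
      _ = _ := by
        rw [← Real.exp_nat_mul]
        ring_nf
  have h2K : ((2 : ℝ) ^ K) * (1 / 2) ^ K = 1 := by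
    rw [← mul_pow]
    norm_num
  calc ((univ.filter fun f : V → V => (I.filter fun s => E s f).card < K).card : ℝ)
      = 2 ^ K * (((univ.filter fun f : V → V => (I.filter fun s => E s f).card < K).card : ℝ) *
        (1 / 2) ^ K) := by
        linear_combination
          (-((univ.filter fun f : V → V => (I.filter fun s => E s f).card < K).card : ℝ)) * h2K
    _ ≤ 2 ^ K * ((1 - p / 2) ^ I.card * N) := by
        exact mul_le_mul_of_nonneg_left (hmarkov.trans (hprod I subset_rfl)) (by positivity)
    _ ≤ 2 ^ K * (Real.exp (-(p * I.card / 2)) * N) := by gcongr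
    _ = _ := by ring

end Functions

/-! ### Absorbers in random relabellings -/

section RandomAbsorbers

variable {V : Type*} [Fintype V] [DecidableEq V]

/-- The vertex `s` and its neighbours. -/
noncomputable def closedStar (T : SimpleGraph V) (s : V) : Finset V :=
  insert s (univ.filter fun t => T.Adj s t)

theorem card_closedStar_le {T : SimpleGraph V} {Δ : ℕ}
    (hΔ : ∀ v, (univ.filter fun w => T.Adj v w).card ≤ Δ) (s : V) :
    (closedStar T s).card ≤ Δ + 1 :=
  (card_insert_le _ _).trans (Nat.succ_le_succ (hΔ s))

/-- A bounded degree graph has linearly many disjoint stars. -/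
theorem exists_disjoint_closedStar {T : SimpleGraph V} {Δ : ℕ}
    (hΔ : ∀ v, (univ.filter fun w => T.Adj v w).card ≤ Δ) :
    ∃ I : Finset V, (∀ s ∈ I, ∀ t ∈ I, s ≠ t → Disjoint (closedStar T s) (closedStar T t)) ∧
      Fintype.card V ≤ I.card * (Δ + 1) ^ 2 := by
  obtain ⟨I, hI, hmax⟩ := exists_max_image (univ.filter fun I : Finset V =>
    ∀ s ∈ I, ∀ t ∈ I, s ≠ t → Disjoint (closedStar T s) (closedStar T t)) Finset.card
    ⟨∅, by simp⟩
  simp only [mem_filter, mem_univ, true_and] at hI hmax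
  refine ⟨I, hI, ?_⟩
  have hmem : ∀ a b, a ∈ closedStar T b ↔ b ∈ closedStar T a := by
    intro a b
    simp only [closedStar, mem_insert, mem_filter, mem_univ, true_and, T.adj_comm b a]
    tauto
  have hcover : (univ : Finset V) ⊆ I.biUnion fun i => (closedStar T i).biUnion (closedStar T) := by
    intro s _
    simp only [mem_biUnion]
    by_cases hs : s ∈ I
    · exact ⟨s, hs, s, by simp [closedStar], by simp [closedStar]⟩
    by_contra! hcon
    have hd : ∀ i ∈ I, Disjoint (closedStar T s) (closedStar T i) := fun i hi =>
      disjoint_left.2 fun t hts hti => hcon i hi t hti ((hmem _ _).1 hts)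
    have := hmax (insert s I) (by
      intro a ha b hb hab
      rcases mem_insert.1 ha with rfl | ha <;> rcases mem_insert.1 hb with rfl | hb
      · exact absurd rfl hab
      · exact hd b hb
      · exact (hd a (by assumption)).symm
      · exact hI a ha b hb hab)
    rw [card_insert_of_notMem hs] at this
    omega
  calc Fintype.card V = (univ : Finset V).card := card_univ.symm
    _ ≤ _ := card_le_card hcover
    _ ≤ I.card * ((Δ + 1) * (Δ + 1)) := card_biUnion_le_card_mul _ _ _ fun i _ =>
        (card_biUnion_le_card_mul _ _ _ fun t _ => card_closedStar_le hΔ t).trans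
          (Nat.mul_le_mul_right _ (card_closedStar_le hΔ i))
    _ = _ := by ring

/-- The probability that a tree vertex is an absorber under a random function. -/
theorem le_card_filter_mem_absorbers {G T : SimpleGraph V} {Δ : ℕ} {a : ℝ} (ha0 : 0 ≤ a)
    (ha1 : a ≤ 1) (hG : ∀ v, a * Fintype.card V ≤ (univ.filter fun w => G.Adj v w).card)
    (hΔ : ∀ v, (univ.filter fun w => T.Adj v w).card ≤ Δ) (x u s : V) :
    a ^ (Δ + 1) * (Fintype.card V : ℝ) ^ Fintype.card V ≤
      (univ.filter fun f : V → V => G.Adj x (f s) ∧ ∀ t, T.Adj s t → G.Adj u (f t)).card := by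
  have h1 : (univ.filter fun f : V → V => G.Adj x (f s) ∧ ∀ t, T.Adj s t → G.Adj u (f t)) =
      Fintype.piFinset fun v => if v = s then univ.filter fun w => G.Adj x w else
        if T.Adj s v then univ.filter fun w => G.Adj u w else univ := by
    ext f
    simp only [mem_filter, mem_univ, true_and, Fintype.mem_piFinset]
    constructor
    · rintro ⟨hs, ht⟩ v
      split_ifs with h1 h2
      · simpa [h1] using hs
      · simpa using ht v h2
      · simp
    · intro h
      refine ⟨by simpa using h s, fun t ht => ?_⟩
      have := h t
      rw [if_neg ht.ne', if_pos ht] at this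
      simpa using this
  rw [h1, Fintype.card_piFinset]
  push_cast
  have h2 : ∀ v, (if v ∈ closedStar T s then a else 1) * (Fintype.card V : ℝ) ≤
      ((if v = s then univ.filter fun w => G.Adj x w else
        if T.Adj s v then univ.filter fun w => G.Adj u w else univ).card : ℝ) := by
    intro v
    by_cases hv : v = s
    · simpa [hv, closedStar] using hG x
    · by_cases hv' : T.Adj s v
      · simpa [hv, hv', closedStar] using hG u
      · simp [hv, hv', closedStar]
  refine le_trans ?_ (prod_le_prod (fun v _ => ?_) fun v _ => h2 v)
  · rw [prod_mul_distrib, prod_const, card_univ, prod_ite_mem, univ_inter, prod_const]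
    gcongr ?_ * _
    exact pow_le_pow_of_le_one ha0 ha1 (card_closedStar_le hΔ s)
  · split_ifs <;> positivity

/-- Under a random bijection all pairs of vertices have many absorbers. -/
theorem card_perm_absorbers_lt_le {G T : SimpleGraph V} {Δ : ℕ} {a : ℝ} (ha0 : 0 ≤ a)
    (ha1 : a ≤ 1) (hG : ∀ v, a * Fintype.card V ≤ (univ.filter fun w => G.Adj v w).card)
    (hΔ : ∀ v, (univ.filter fun w => T.Adj v w).card ≤ Δ) (K : ℕ) :
    ((univ.filter fun φ : Equiv.Perm V => ∃ x u, (absorbers G T φ x u).card < K).card : ℝ) ≤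
      (Fintype.card V : ℝ) ^ 2 * ((Real.exp 1 * (Fintype.card V + 1)) ^ 4 *
        (2 ^ K * Real.exp (-(a ^ (Δ + 1) * Fintype.card V / (2 * (Δ + 1) ^ 2))))) *
        (Fintype.card V).factorial := by
  set N : ℝ := (Fintype.card V : ℝ) ^ Fintype.card V with hN
  have hNpos : 0 < N := by
    rw [hN]
    rcases Nat.eq_zero_or_pos (Fintype.card V) with h | h
    · simp [h]
    · positivity
  obtain ⟨I, hI, hIcard⟩ := exists_disjoint_closedStar hΔ
  have hfun : ∀ x u, ((univ.filter fun f : V → V => (absorbers G T f x u).card < K).card : ℝ) ≤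
      2 ^ K * Real.exp (-(a ^ (Δ + 1) * Fintype.card V / (2 * (Δ + 1) ^ 2))) * N := by
    intro x u
    have h1 := card_filter_card_lt_le (p := a ^ (Δ + 1))
      (E := fun s f => G.Adj x (f s) ∧ ∀ t, T.Adj s t → G.Adj u (f t))
      hI (by
        intro s f f' h
        have h1 : f s = f' s := h s (by simp [closedStar])
        have h2 : ∀ t, T.Adj s t → f t = f' t := fun t ht => h t (by simp [closedStar, ht])
        rw [h1]
        exact and_congr_right fun _ => forall₂_congr fun t ht => by rw [h2 t ht])
      (pow_le_one₀ ha0 ha1)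
      (fun s => by convert le_card_filter_mem_absorbers ha0 ha1 hG hΔ x u s) K
    refine le_trans (Nat.cast_le.2 (card_le_card ?_)) (h1.trans ?_)
    · intro f hf
      simp only [mem_filter, mem_univ, true_and] at hf ⊢
      refine lt_of_le_of_lt (card_le_card ?_) hf
      intro s hs
      simp only [mem_filter] at hs
      simpa [absorbers] using hs.2
    · gcongr 2 ^ K * Real.exp (-?_) * _
      rw [div_le_div_iff₀ (by positivity) (by norm_num)]
      have : (Fintype.card V : ℝ) ≤ I.card * (Δ + 1) ^ 2 := by exact_mod_cast hIcard
      have h3 : 0 ≤ a ^ (Δ + 1) := by positivity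
      nlinarith [mul_le_mul_of_nonneg_left this h3]
  have hperm : ∀ x u,
      ((univ.filter fun φ : Equiv.Perm V => (absorbers G T φ x u).card < K).card : ℝ) ≤
      (Real.exp 1 * (Fintype.card V + 1)) ^ 4 *
        (2 ^ K * Real.exp (-(a ^ (Δ + 1) * Fintype.card V / (2 * (Δ + 1) ^ 2)))) *
        (Fintype.card V).factorial := by
    intro x u
    -- whether `s` is an absorber depends only on the adjacencies of the images to `x` and `u`
    have h1 := card_perm_comp_mem_mul_le
      (fun w : V => (decide (G.Adj x w), decide (G.Adj u w)))
      {τ | (univ.filter fun s => (τ s).1 = true ∧ ∀ t, T.Adj s t → (τ t).2 = true).card < K}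
    have h2 : ∀ f : V → V, (fun w : V => (decide (G.Adj x w), decide (G.Adj u w))) ∘ f ∈
        {τ : V → Bool × Bool |
          (univ.filter fun s => (τ s).1 = true ∧ ∀ t, T.Adj s t → (τ t).2 = true).card < K} ↔
        (absorbers G T f x u).card < K := by
      intro f
      simp [absorbers]
    simp only [h2] at h1
    have h3 : Fintype.card (Bool × Bool) = 4 := rfl
    rw [h3] at h1
    refine le_of_mul_le_mul_right (h1.trans ?_) hNpos
    calc _ ≤ (Real.exp 1 * (Fintype.card V + 1)) ^ 4 *
          (2 ^ K * Real.exp (-(a ^ (Δ + 1) * Fintype.card V / (2 * (Δ + 1) ^ 2))) * N) *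
          (Fintype.card V).factorial := by
            gcongr
            exact hfun x u
      _ = _ := by ring
  have hunion : (univ.filter fun φ : Equiv.Perm V => ∃ x u, (absorbers G T φ x u).card < K) ⊆
      (univ : Finset (V × V)).biUnion fun q =>
        univ.filter fun φ : Equiv.Perm V => (absorbers G T φ q.1 q.2).card < K := by
    intro φ hφ
    simpa using hφ
  calc ((univ.filter fun φ : Equiv.Perm V => ∃ x u, (absorbers G T φ x u).card < K).card : ℝ)
      ≤ ∑ q : V × V, ((univ.filter fun φ : Equiv.Perm V =>
          (absorbers G T φ q.1 q.2).card < K).card : ℝ) := by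
        exact_mod_cast (card_le_card hunion).trans card_biUnion_le
    _ ≤ ∑ _q : V × V, _ := sum_le_sum fun q _ => hperm q.1 q.2
    _ = _ := by
        rw [sum_const, card_univ, Fintype.card_prod, nsmul_eq_mul]
        push_cast
        ring

end RandomAbsorbers

/-! ### Graphs of large minimum degree -/

section Packing

variable {V : Type*} [Fintype V] [DecidableEq V]

/-- The Sauer–Spencer argument: a bijection from `T` to `G` with fewest edges mapped to non-edges
maps no edge to a non-edge, for otherwise the images of an end of such an edge and of some other
vertex could be exchanged. -/
theorem isContained_of_compl_degree_le {G T : SimpleGraph V} {Δ d : ℕ}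
    (hT : ∀ v, (univ.filter fun w => T.Adj v w).card ≤ Δ)
    (hG : ∀ v, (univ.filter fun w => Gᶜ.Adj v w).card ≤ d)
    (hd : 2 * Δ * d + 1 < Fintype.card V) : T ⊑ G := by
  -- the pairs of tree vertices that form an edge mapped to a non-edge
  set bad : Equiv.Perm V → Finset (V × V) := fun π =>
    univ.filter fun q => T.Adj q.1 q.2 ∧ Gᶜ.Adj (π q.1) (π q.2) with hbad
  obtain ⟨π, -, hmin⟩ := exists_min_image (univ : Finset (Equiv.Perm V)) (fun π => (bad π).card)
    univ_nonempty
  by_cases h0 : bad π = ∅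
  · refine ⟨⟨⟨π, fun {u v} huv => ?_⟩, π.injective⟩⟩
    have h1 : (u, v) ∉ bad π := by simp [h0]
    simp only [hbad, mem_filter, mem_univ, true_and, not_and, SimpleGraph.compl_adj, not_not] at h1
    exact h1 huv fun h => huv.ne (π.injective h)
  exfalso
  obtain ⟨⟨u, v⟩, huv⟩ := nonempty_iff_ne_empty.2 h0
  simp only [hbad, mem_filter, mem_univ, true_and] at huv
  set X₁ := (univ.filter fun t => T.Adj u t).biUnion fun t =>
    univ.filter fun w => Gᶜ.Adj (π t) (π w) with hX₁
  set X₂ := (univ.filter fun z => Gᶜ.Adj (π u) (π z)).biUnion fun z =>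
    univ.filter fun w => T.Adj z w with hX₂
  have hG' : ∀ y, (univ.filter fun w => Gᶜ.Adj y (π w)).card ≤ d := by
    intro y
    refine le_trans (card_le_card_of_injOn π (fun w hw => ?_) π.injective.injOn) (hG y)
    simpa using hw
  have hc₁ : X₁.card ≤ Δ * d :=
    (card_biUnion_le_card_mul _ _ d fun t _ => hG' (π t)).trans (Nat.mul_le_mul_right _ (hT u))
  have hc₂ : X₂.card ≤ d * Δ :=
    (card_biUnion_le_card_mul _ _ Δ fun z _ => hT z).trans (Nat.mul_le_mul_right _ (hG' (π u)))
  obtain ⟨w, hw⟩ : ∃ w, w ∉ insert v (X₁ ∪ X₂) := by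
    by_contra! h
    have h1 := congrArg Finset.card (eq_univ_iff_forall.2 h)
    have h2 := card_insert_le v (X₁ ∪ X₂)
    have h3 := card_union_le X₁ X₂
    rw [card_univ] at h1
    have h4 : 2 * Δ * d = Δ * d + d * Δ := by ring
    omega
  simp only [mem_insert, mem_union, not_or, hX₁, hX₂, mem_biUnion, mem_filter, mem_univ,
    true_and, not_exists, not_and] at hw
  obtain ⟨hwv, hw₁, hw₂⟩ := hw
  have hwu : w ≠ u := by
    rintro rfl
    exact hw₁ v huv.1 huv.2.symm
  set π' : Equiv.Perm V := (Equiv.swap u w).trans π with hπ'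
  have hu : π' u = π w := by simp [hπ']
  have hw' : π' w = π u := by simp [hπ']
  have ho : ∀ t, t ≠ u → t ≠ w → π' t = π t := fun t h1 h2 => by
    simp [hπ', Equiv.swap_apply_of_ne_of_ne h1 h2]
  -- no edge at `u` or `w` other than `uw` is mapped to a non-edge after the exchange
  have hbu : ∀ t, t ≠ w → T.Adj u t → ¬ Gᶜ.Adj (π' u) (π' t) := by
    intro t htw hut h
    rw [hu, ho t hut.ne' htw] at h
    exact hw₁ t hut h.symm
  have hbw : ∀ t, t ≠ u → T.Adj w t → ¬ Gᶜ.Adj (π' w) (π' t) := by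
    intro t htu hwt h
    rw [hw', ho t htu hwt.ne'] at h
    exact hw₂ t h hwt.symm
  refine absurd (hmin π' (mem_univ _)) (not_le.2 (card_lt_card ⟨?_, ?_⟩))
  · rintro ⟨a, b⟩ hab
    simp only [hbad, mem_filter, mem_univ, true_and] at hab ⊢
    obtain ⟨hT', hG''⟩ := hab
    refine ⟨hT', ?_⟩
    by_cases hau : a = u
    · by_cases hbw' : b = w
      · subst hau hbw'
        rw [hu, hw'] at hG''
        exact hG''.symm
      · subst hau
        exact absurd hG'' (hbu b hbw' hT')
    · by_cases haw : a = w
      · by_cases hbu' : b = u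
        · subst haw hbu'
          rw [hu, hw'] at hG''
          exact hG''.symm
        · subst haw
          exact absurd hG'' (hbw b hbu' hT')
      · by_cases hbu' : b = u
        · subst hbu'
          exact absurd hG''.symm (hbu a haw hT'.symm)
        · by_cases hbw' : b = w
          · subst hbw'
            exact absurd hG''.symm (hbw a hau hT'.symm)
          · rwa [ho a hau haw, ho b hbu' hbw'] at hG''
  · intro h
    have := @h (u, v) (by simpa [hbad] using huv)
    simp only [hbad, mem_filter, mem_univ, true_and] at this
    exact hbu v (Ne.symm hwv) this.1 this.2

end Packing

/-! ### The binomial random graph -/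

section Gnp

instance {n : ℕ} {p : ℝ} : IsProbabilityMeasure (gnp n p) := by
  unfold gnp
  infer_instance

instance {n : ℕ} : MeasurableSingletonClass (SimpleGraph (Fin n)) where
  measurableSet_singleton G := by
    have h : ({G} : Set (SimpleGraph (Fin n))) = SimpleGraph.edgeSet ⁻¹' {G.edgeSet} := by
      ext H
      simp
    rw [h]
    exact SimpleGraph.measurableEmbedding_edgeSet.measurable (measurableSet_singleton _)

theorem gnp_of_one_le {n : ℕ} {p : ℝ} (hp : 1 ≤ p) : gnp n p = Measure.dirac ⊤ := by
  rw [gnp, Set.projIcc_of_right_le _ hp]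
  exact SimpleGraph.binomialRandom_one _

/-- The distribution `G(n, p)` is invariant under relabelling the vertices. -/
theorem gnp_real_preimage_map {n : ℕ} (p : ℝ) (σ : Equiv.Perm (Fin n))
    (S : Set (SimpleGraph (Fin n))) :
    (gnp n p).real {H | H.map σ.toEmbedding ∈ S} = (gnp n p).real S := by
  have hmap : Function.Bijective fun H : SimpleGraph (Fin n) => H.map σ.toEmbedding := by
    rw [← Finite.injective_iff_bijective]
    exact SimpleGraph.map_injective _
  have hone : ∀ H : SimpleGraph (Fin n),
      (gnp n p).real {H.map σ.toEmbedding} = (gnp n p).real {H} := by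
    intro H
    have h1 : (H.map σ.toEmbedding).edgeSet.ncard = H.edgeSet.ncard := by
      rw [SimpleGraph.edgeSet_map]
      exact Set.ncard_image_of_injective _ (Function.Embedding.injective _)
    simp only [Measure.real, gnp, SimpleGraph.binomialRandom_singleton, h1]
  have hsum : ∀ S : Set (SimpleGraph (Fin n)), (gnp n p).real S =
      ∑ H ∈ univ.filter (· ∈ S), (gnp n p).real {H} := by
    intro S
    rw [sum_measureReal_singleton]
    congr 1
    ext H
    simp
  rw [hsum, hsum]
  refine sum_bij (fun H _ => H.map σ.toEmbedding) (fun H hH => by simpa using hH)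
    (fun H _ H' _ h => hmap.1 h) (fun H hH => ?_) (fun H _ => (hone H).symm)
  obtain ⟨H', rfl⟩ := hmap.2 H
  exact ⟨H', by simpa using hH, rfl⟩

/-- The probability that none of the pairs in a set `F` is an edge. -/
theorem gnp_real_disjoint_le {n : ℕ} {p : ℝ} (hp0 : 0 ≤ p) (hp1 : p ≤ 1)
    (F : Finset (Sym2 (Fin n))) (hF : ∀ e ∈ F, ¬ e.IsDiag) :
    (gnp n p).real {H | ∀ e ∈ F, e ∉ H.edgeSet} ≤ (1 - p) ^ F.card := by
  rw [gnp, Set.projIcc_of_mem _ ⟨hp0, hp1⟩, Measure.real, SimpleGraph.binomialRandom_apply]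
  rw [← ENNReal.toReal_ofReal (pow_nonneg (by linarith : (0 : ℝ) ≤ 1 - p) F.card)]
  refine ENNReal.toReal_mono ENNReal.ofReal_ne_top ?_
  refine (measure_mono (t := (↑F : Set (Sym2 (Fin n))).pi fun _ => {False}) ?_).trans ?_
  · rintro _ ⟨H, hH, rfl⟩ e he
    simpa using hH e he
  · rw [Measure.infinitePi_pi _ fun _ _ => measurableSet_singleton _]
    rw [prod_congr rfl (g := fun _ => ENNReal.ofReal (1 - p)), prod_const,
      ENNReal.ofReal_pow (by linarith)]
    intro e he
    have := hF e he
    have h1 : (unitInterval.toNNReal (unitInterval.symm ⟨p, hp0, hp1⟩) : ENNReal) =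
        ENNReal.ofReal (1 - p) := by
      rw [ENNReal.ofReal, ENNReal.coe_inj]
      ext
      simp [hp1]
    simpa [this] using h1

theorem gnp_real_not_isJoined_le {n : ℕ} {p : ℝ} (hp0 : 0 ≤ p) (hp1 : p ≤ 1) (m : ℕ) :
    (gnp n p).real {H | ¬ IsJoined H m} ≤ (n.choose m : ℝ) ^ 2 * (1 - p) ^ (m * m) := by
  set P := ((univ : Finset (Fin n)).powersetCard m ×ˢ (univ : Finset (Fin n)).powersetCard m).filter
    fun q => Disjoint q.1 q.2 with hP
  have hsub : {H | ¬ IsJoined H m} ⊆ ⋃ q ∈ P, {H : SimpleGraph (Fin n) |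
      ∀ e ∈ (q.1 ×ˢ q.2).image fun ab : Fin n × Fin n => s(ab.1, ab.2), e ∉ H.edgeSet} := by
    intro H hH
    simp only [Set.mem_ofPred_eq, IsJoined, not_forall, not_exists, not_and] at hH
    obtain ⟨A, B, hAB, hA, hB, h⟩ := hH
    simp only [Set.mem_iUnion]
    refine ⟨(A, B), by simp [hP, hA, hB, hAB], ?_⟩
    simp only [Set.mem_ofPred_eq, mem_image, mem_product]
    rintro _ ⟨⟨a, b⟩, ⟨ha, hb⟩, rfl⟩
    exact h a ha b hb
  refine (measureReal_mono hsub (measure_ne_top _ _)).trans ((measureReal_biUnion_finset_le _ _).trans ?_)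
  have hone : ∀ q ∈ P, (gnp n p).real {H : SimpleGraph (Fin n) |
      ∀ e ∈ (q.1 ×ˢ q.2).image fun ab : Fin n × Fin n => s(ab.1, ab.2), e ∉ H.edgeSet} ≤
      (1 - p) ^ (m * m) := by
    rintro ⟨A, B⟩ hq
    simp only [hP, mem_filter, mem_product, mem_powersetCard, subset_univ, true_and] at hq
    obtain ⟨⟨hA, hB⟩, hAB⟩ := hq
    have hne : ∀ a ∈ A, ∀ b ∈ B, a ≠ b := fun a ha b hb h => disjoint_left.1 hAB ha (h ▸ hb)
    refine (gnp_real_disjoint_le hp0 hp1 _ ?_).trans_eq ?_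
    · simp only [mem_image, mem_product]
      rintro _ ⟨⟨a, b⟩, ⟨ha, hb⟩, rfl⟩
      simpa using hne a ha b hb
    · rw [card_image_of_injOn, card_product, hA, hB]
      rintro ⟨a, b⟩ hab ⟨a', b'⟩ hab' h
      simp only [coe_product, Set.mem_prod, mem_coe] at hab hab'
      rcases Sym2.eq_iff.1 h with ⟨h1, h2⟩ | ⟨h1, h2⟩
      · exact Prod.ext h1 h2
      · exact absurd h1 (hne a hab.1 b' hab'.2)
  refine (sum_le_card_nsmul _ _ _ hone).trans ?_
  rw [nsmul_eq_mul]
  have hcard : (P.card : ℝ) ≤ (n.choose m : ℝ) ^ 2 := by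
    have h1 : P.card ≤ n.choose m * n.choose m := by
      refine (card_filter_le _ _).trans_eq ?_
      rw [card_product, card_powersetCard, card_univ, Fintype.card_fin]
    rw [pow_two]
    exact_mod_cast h1
  have : 0 ≤ 1 - p := by linarith
  gcongr

end Gnp

/-! ### Reduction to random relabellings of a fixed graph -/

/-- If random relabellings of every joined graph complete `G` to a graph containing `T` with
probability at least `1 - b`, then so does `G(n, p)`, up to the probability that it is not joined:
its distribution does not change when it is relabelled at random. -/
theorem one_sub_le_perturbedContainProb {n m : ℕ} {G T : SimpleGraph (Fin n)} {p a b : ℝ}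
    (hb : 0 ≤ b) (ha : (gnp n p).real {H | ¬ IsJoined H m} ≤ a)
    (hJ : ∀ H : SimpleGraph (Fin n), IsJoined H m →
      ((univ.filter fun σ : Equiv.Perm (Fin n) => ¬ T ⊑ G ⊔ H.map σ.toEmbedding).card : ℝ) ≤
        b * n.factorial) :
    1 - (a + b) ≤ perturbedContainProb G T p := by
  set S : Set (SimpleGraph (Fin n)) := {H | ¬ T ⊑ G ⊔ H} with hS
  have hsum : ∀ S : Set (SimpleGraph (Fin n)), (gnp n p).real S =
      ∑ H, (gnp n p).real {H} * S.indicator 1 H := by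
    intro S
    have h1 : ∀ H, (gnp n p).real {H} * S.indicator 1 H =
        if H ∈ S then (gnp n p).real {H} else 0 := by
      intro H
      simp [Set.indicator_apply]
    rw [sum_congr rfl fun H _ => h1 H, ← sum_filter, sum_measureReal_singleton]
    congr 1
    ext H
    simp
  have hcompl : perturbedContainProb G T p = 1 - (gnp n p).real S := by
    rw [perturbedContainProb, ← probReal_compl_eq_one_sub (Set.toFinite S).measurableSet]
    congr 1
    ext H
    simp [hS]
  have hnpos : (0 : ℝ) < n.factorial := by exact_mod_cast n.factorial_pos
  have hmain : (n.factorial : ℝ) * (gnp n p).real S ≤ n.factorial * (a + b) := by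
    calc (n.factorial : ℝ) * (gnp n p).real S
        = ∑ σ : Equiv.Perm (Fin n), (gnp n p).real {H | H.map σ.toEmbedding ∈ S} := by
          rw [sum_congr rfl fun σ _ => gnp_real_preimage_map p σ S, sum_const, card_univ,
            Fintype.card_perm, Fintype.card_fin, nsmul_eq_mul]
      _ = ∑ H, (gnp n p).real {H} *
            (univ.filter fun σ : Equiv.Perm (Fin n) => ¬ T ⊑ G ⊔ H.map σ.toEmbedding).card := by
          rw [sum_congr rfl fun σ _ => hsum _, sum_comm]
          refine sum_congr rfl fun H _ => ?_
          rw [← mul_sum, card_filter]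
          push_cast
          refine congrArg _ (sum_congr rfl fun σ _ => ?_)
          by_cases h : ¬ T ⊑ G ⊔ H.map σ.toEmbedding
          · rw [if_pos h]
            exact Set.indicator_of_mem h _
          · rw [if_neg h]
            exact Set.indicator_of_notMem h _
      _ ≤ ∑ H, ((gnp n p).real {H} * Set.indicator {H | ¬ IsJoined H m} 1 H * n.factorial +
            (gnp n p).real {H} * (b * n.factorial)) := by
          refine sum_le_sum fun H _ => ?_
          have h0 : 0 ≤ (gnp n p).real {H} := measureReal_nonneg
          by_cases hH : IsJoined H m
          · rw [Set.indicator_of_notMem (by simpa using hH), mul_zero, zero_mul, zero_add]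
            exact mul_le_mul_of_nonneg_left (hJ H hH) h0
          · rw [Set.indicator_of_mem (by simpa using hH), Pi.one_apply, mul_one]
            have h1 : ((univ.filter fun σ : Equiv.Perm (Fin n) =>
                ¬ T ⊑ G ⊔ H.map σ.toEmbedding).card : ℝ) ≤ n.factorial := by
              have := card_filter_le (univ : Finset (Equiv.Perm (Fin n)))
                fun σ => ¬ T ⊑ G ⊔ H.map σ.toEmbedding
              rw [card_univ, Fintype.card_perm, Fintype.card_fin] at this
              exact_mod_cast this
            have h2 : 0 ≤ (gnp n p).real {H} * (b * n.factorial) := by positivity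
            linarith [mul_le_mul_of_nonneg_left h1 h0]
      _ = n.factorial * ((gnp n p).real {H | ¬ IsJoined H m} + b) := by
          have h1 : ∑ H, (gnp n p).real {H} = 1 := by
            simp
          rw [sum_add_distrib, ← sum_mul, ← hsum, ← sum_mul, h1]
          ring
      _ ≤ _ := by gcongr
  rw [hcompl]
  have := le_of_mul_le_mul_left hmain hnpos
  linarith

/-- The relabellings of a joined graph that fail to complete `G` are at most as many as the
bijections with too few absorbers. -/
theorem card_perm_not_isContained_le {n m Δ : ℕ} {G T H : SimpleGraph (Fin n)} (hT : T.IsTree)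
    (hΔ : ∀ v, (univ.filter fun w => T.Adj v w).card ≤ Δ) (hJ : IsJoined H m) (hm : 1 ≤ m)
    (hn : (2 * Δ + 6) * m < n) :
    (univ.filter fun σ : Equiv.Perm (Fin n) => ¬ T ⊑ G ⊔ H.map σ.toEmbedding).card ≤
      (univ.filter fun φ : Equiv.Perm (Fin n) => ∃ x u,
        (absorbers G T φ x u).card < (Δ + 3) * ((2 * Δ + 6) * m) + 1).card := by
  obtain ⟨ρ⟩ := hT.nonempty_rooting
  obtain ⟨A, hA, hAcard, φ, hinj, hφ⟩ := hJ.exists_embedding ρ hm hΔ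
    (k := n - (2 * Δ + 6) * m) (by omega) (by rw [Fintype.card_fin]; omega)
  obtain ⟨g, hg⟩ : ∃ g : Equiv.Perm (Fin n), ∀ a ∈ A, g a = φ a := by
    obtain ⟨g, hg⟩ := Finset.exists_equiv_extend_of_card_eq (t := (univ : Finset (Fin n)))
      (by simp) (s := A) (f := φ) (by simp) hinj
    exact ⟨g.trans (Equiv.subtypeUnivEquiv fun x => mem_univ x), fun a ha => hg a ha⟩
  refine card_le_card_of_injOn (fun σ => g.trans σ) (fun σ hσ => ?_) fun σ _ σ' _ h => ?_
  · simp only [coe_filter, mem_univ, true_and, Set.mem_ofPred_eq] at hσ ⊢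
    by_contra! hcon
    refine hσ (isContained_sup_of_absorbers ρ hΔ hA (L := (2 * Δ + 6) * m) ?_ (g.trans σ) ?_ ?_)
    · rw [hAcard, Fintype.card_fin]
      omega
    · intro v hv hvr
      rw [Equiv.trans_apply, Equiv.trans_apply, hg v hv, hg _ (hA.2 v hv hvr)]
      exact (SimpleGraph.map_adj _ _ _ _).2 ⟨_, _, hφ v hv hvr, rfl, rfl⟩
    · exact fun x u => hcon x u
  · ext x
    simpa using congrArg (fun e : Equiv.Perm (Fin n) => (e (g.symm x) : ℕ)) h

/-! ### Estimates -/

theorem choose_le_exp_mul_div_pow (n : ℕ) {m : ℕ} (hm : 1 ≤ m) :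
    (n.choose m : ℝ) ≤ (Real.exp 1 * n / m) ^ m := by
  have hm0 : (0 : ℝ) < m := by exact_mod_cast hm
  have h1 : (n.choose m : ℝ) ≤ (n : ℝ) ^ m / m.factorial := Nat.choose_le_pow_div m n
  have h2 := Real.pow_div_factorial_le_exp (m : ℝ) hm0.le m
  rw [div_le_iff₀ (by positivity)] at h2
  have h3 : Real.exp m = Real.exp 1 ^ m := by rw [← Real.exp_nat_mul, mul_one]
  refine h1.trans ?_
  rw [div_pow, mul_pow, div_le_div_iff₀ (by positivity) (by positivity), ← h3]
  calc (n : ℝ) ^ m * (m : ℝ) ^ m ≤ (n : ℝ) ^ m * (Real.exp m * m.factorial) := by gcongr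
    _ = _ := by ring

/-- The union bound over pairs of sets of `m` vertices, where `m` is of order `a ^ (Δ + 1) * n` and
the edge probability is of order `log (1 / a) / m` with a large constant. -/
theorem choose_sq_mul_pow_le {n m Δ : ℕ} {a p C κ : ℝ} (hΔ : 1 ≤ Δ) (ha0 : 0 < a)
    (ha1 : a ≤ 1 - 1 / (4 * Δ)) (hκ0 : 0 < κ) (hκ1 : κ ≤ 1) (hn : 0 < n) (hm : 1 ≤ m)
    (hmκ : κ * (a ^ (Δ + 1) * n) / 2 ≤ m)
    (hC : 8 * Δ * Real.log (2 * Real.exp 1 / κ) + 2 * (Δ + 1) + 4 * Δ ≤ C * κ / 2)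
    (hp : p = C * Real.log (1 / a) / (a ^ (Δ + 1) * n)) (hp1 : p ≤ 1) :
    (n.choose m : ℝ) ^ 2 * (1 - p) ^ (m * m) ≤ Real.exp (-m) := by
  have hn0 : (0 : ℝ) < n := by exact_mod_cast hn
  have hm0 : (0 : ℝ) < m := by exact_mod_cast hm
  have hΔ0 : (0 : ℝ) < Δ := by exact_mod_cast hΔ
  have hs : 0 < a ^ (Δ + 1) * n := by positivity
  set lam := Real.log (1 / a) with hlam
  have hlam0 : 1 ≤ 4 * Δ * lam := by
    have h1 := Real.one_sub_inv_le_log_of_pos (x := 1 / a) (by positivity)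
    rw [one_div, inv_inv, ← one_div, ← hlam] at h1
    have h2 : 1 / (4 * (Δ : ℝ)) ≤ lam := by linarith
    rwa [div_le_iff₀ (by positivity), mul_comm] at h2
  have hlampos : 0 < lam := by
    by_contra! h
    nlinarith
  set l₀ := Real.log (2 * Real.exp 1 / κ) with hl₀
  have hl₀0 : 0 ≤ l₀ := by
    refine Real.log_nonneg ?_
    rw [le_div_iff₀ hκ0]
    have := Real.add_one_le_exp 1
    linarith
  have hchoose : (n.choose m : ℝ) ≤ Real.exp (m * (l₀ + (Δ + 1) * lam)) := by
    refine (choose_le_exp_mul_div_pow n hm).trans ?_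
    rw [Real.exp_nat_mul]
    refine pow_le_pow_left₀ (by positivity) ?_ m
    have h1 : Real.exp ((Δ + 1) * lam) = (a ^ (Δ + 1))⁻¹ := by
      have : ((Δ : ℝ) + 1) = ((Δ + 1 : ℕ) : ℝ) := by push_cast; ring
      rw [this, Real.exp_nat_mul, hlam, Real.exp_log (by positivity), one_div, inv_pow]
    rw [Real.exp_add, h1, hl₀, Real.exp_log (by positivity), div_le_iff₀ hm0]
    calc Real.exp 1 * n = 2 * Real.exp 1 / κ * (a ^ (Δ + 1))⁻¹ * (κ * (a ^ (Δ + 1) * n) / 2) := by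
          field_simp
      _ ≤ _ := by gcongr
  have hC0 : 0 ≤ C := by
    have h1 : 0 ≤ 8 * Δ * l₀ := by positivity
    by_contra! h
    nlinarith [mul_neg_of_neg_of_pos h hκ0]
  have hp0 : 0 ≤ p := by
    rw [hp]
    positivity
  have hpm : C * κ / 2 * lam ≤ p * m := by
    calc C * κ / 2 * lam = p * (κ * (a ^ (Δ + 1) * n) / 2) := by
          rw [hp]
          field_simp
      _ ≤ _ := by gcongr
  have hexp : (1 - p) ^ (m * m) ≤ Real.exp (-(p * m * m)) := by
    calc (1 - p) ^ (m * m) ≤ Real.exp (-p) ^ (m * m) :=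
          pow_le_pow_left₀ (by linarith) (Real.one_sub_le_exp_neg p) _
      _ = _ := by
        rw [← Real.exp_nat_mul]
        push_cast
        ring_nf
  calc (n.choose m : ℝ) ^ 2 * (1 - p) ^ (m * m)
      ≤ Real.exp (m * (l₀ + (Δ + 1) * lam)) ^ 2 * Real.exp (-(p * m * m)) := by
        have : 0 ≤ 1 - p := by linarith
        gcongr
    _ = Real.exp (m * (2 * (l₀ + (Δ + 1) * lam) - p * m)) := by
        rw [← Real.exp_nat_mul, ← Real.exp_add]
        push_cast
        ring_nf
    _ ≤ Real.exp (-m) := by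
        refine Real.exp_le_exp.2 ?_
        have h1 := mul_le_mul_of_nonneg_right hC hlampos.le
        have h2 : 2 * l₀ ≤ 8 * Δ * l₀ * lam := by nlinarith
        have h3 : 2 * (l₀ + (Δ + 1) * lam) - p * m ≤ -1 := by linarith
        nlinarith

/-- The failure probability for the absorbers is at most of order `1 / n` if `a ^ (Δ + 1) * n` is
at least a large multiple of `log n`. -/
theorem absorbers_error_le {n m Δ : ℕ} {s κ : ℝ} (hn : 1 ≤ n) (hs0 : 0 ≤ s)
    (hκ : κ = 1 / (8 * (Δ + 3) ^ 4)) (hm : m ≤ κ * s)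
    (hs : 32 * (Δ + 1) ^ 2 * Real.log n ≤ s) :
    (n : ℝ) ^ 2 * ((Real.exp 1 * (n + 1)) ^ 4 * (2 ^ ((Δ + 3) * ((2 * Δ + 6) * m) + 1) *
      Real.exp (-(s / (2 * (Δ + 1) ^ 2))))) ≤ 32 * Real.exp 1 ^ 4 / n := by
  have hn0 : (1 : ℝ) ≤ n := by exact_mod_cast hn
  have hΔ0 : (0 : ℝ) ≤ Δ := Nat.cast_nonneg _
  have hK : (2 : ℝ) ^ ((Δ + 3) * ((2 * Δ + 6) * m)) ≤ Real.exp (s / (4 * (Δ + 1) ^ 2)) := by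
    have h1 : (2 : ℝ) ≤ Real.exp 1 := by
      have := Real.add_one_le_exp 1
      linarith
    refine (pow_le_pow_left₀ (by norm_num) h1 _).trans ?_
    rw [← Real.exp_nat_mul, mul_one]
    refine Real.exp_le_exp.2 ?_
    push_cast
    calc ((Δ : ℝ) + 3) * ((2 * Δ + 6) * m) ≤ ((Δ : ℝ) + 3) * ((2 * Δ + 6) * (κ * s)) := by gcongr
      _ = s / (4 * (Δ + 3) ^ 2) := by
        rw [hκ]
        field_simp
        ring
      _ ≤ s / (4 * (Δ + 1) ^ 2) := by gcongr; norm_num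
  have hexp : Real.exp (s / (4 * (Δ + 1) ^ 2)) * Real.exp (-(s / (2 * (Δ + 1) ^ 2))) ≤
      ((n : ℝ) ^ 8)⁻¹ := by
    rw [← Real.exp_add]
    have h1 : s / (4 * ((Δ : ℝ) + 1) ^ 2) + -(s / (2 * (Δ + 1) ^ 2)) =
        -(s / (4 * (Δ + 1) ^ 2)) := by
      field_simp
      ring
    have h2 : 8 * Real.log n ≤ s / (4 * (Δ + 1) ^ 2) := by
      rw [le_div_iff₀ (by positivity)]
      linarith
    have h3 : ((n : ℝ) ^ 8)⁻¹ = Real.exp (-(8 * Real.log n)) := by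
      rw [Real.exp_neg, ← Real.exp_log (by positivity : (0 : ℝ) < (n : ℝ) ^ 8), Real.log_pow]
      norm_num
    rw [h1, h3]
    exact Real.exp_le_exp.2 (by linarith)
  calc (n : ℝ) ^ 2 * ((Real.exp 1 * (n + 1)) ^ 4 * (2 ^ ((Δ + 3) * ((2 * Δ + 6) * m) + 1) *
      Real.exp (-(s / (2 * (Δ + 1) ^ 2)))))
      ≤ (n : ℝ) ^ 2 * ((Real.exp 1 * (n + n)) ^ 4 * (2 * (Real.exp (s / (4 * (Δ + 1) ^ 2)) *
          Real.exp (-(s / (2 * (Δ + 1) ^ 2)))))) := by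
        rw [pow_succ (2 : ℝ), mul_comm _ (2 : ℝ), mul_assoc (2 : ℝ)]
        gcongr
    _ ≤ (n : ℝ) ^ 2 * ((Real.exp 1 * (n + n)) ^ 4 * (2 * ((n : ℝ) ^ 8)⁻¹)) := by gcongr
    _ = 32 * Real.exp 1 ^ 4 / (n : ℝ) ^ 2 := by
        field_simp
        ring
    _ ≤ _ := by
        gcongr
        nlinarith

/-- The case in which the minimum degree of `G` is not close to `n` and the edge probability is
less than one. -/
theorem one_sub_div_le_perturbedContainProb {n Δ : ℕ} {a p C κ K : ℝ} (hΔ : 1 ≤ Δ)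
    (hκ : κ = 1 / (8 * (Δ + 3) ^ 4)) (hK : K = 32 * (Δ + 1) ^ 2 + 1 / κ)
    (hC : 8 * Δ * Real.log (2 * Real.exp 1 / κ) + 2 * (Δ + 1) + 4 * Δ ≤ C * κ / 2)
    (hCK : 2 * (Δ + 1) * K ≤ C) (ha0 : 0 < a) (ha1 : a ≤ 1 - 1 / (4 * Δ))
    (hn2 : 2 ≤ Real.log n) (hnK : K * Real.log n ≤ √n)
    (hp : p = C * Real.log (1 / a) / (a ^ (Δ + 1) * n)) (hp1 : p < 1)
    {G T : SimpleGraph (Fin n)} (hG : ∀ v, a * n ≤ (univ.filter fun w => G.Adj v w).card)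
    (hT : T.IsTree) (hTΔ : ∀ v, (univ.filter fun w => T.Adj v w).card ≤ Δ) :
    1 - (Real.exp 1 + 32 * Real.exp 1 ^ 4) / n ≤ perturbedContainProb G T p := by
  have hn : 1 ≤ n := by
    by_contra! h
    have : n = 0 := by omega
    rw [this, Nat.cast_zero, Real.log_zero] at hn2
    norm_num at hn2
  have hn0 : (0 : ℝ) < n := by exact_mod_cast hn
  have hΔ0 : (1 : ℝ) ≤ Δ := by exact_mod_cast hΔ
  have ha1' : a ≤ 1 := by
    have : 0 ≤ 1 / (4 * (Δ : ℝ)) := by positivity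
    linarith
  have hκ0 : 0 < κ := by
    rw [hκ]
    positivity
  have hκ1 : κ ≤ 1 := by
    rw [hκ, div_le_one (by positivity)]
    have : (1 : ℝ) ≤ (Δ + 3) ^ 4 := one_le_pow₀ (by linarith)
    linarith
  have hK0 : 0 < K := by
    rw [hK]
    positivity
  set s := a ^ (Δ + 1) * (n : ℝ) with hsdef
  have hs0 : 0 < s := by positivity
  have hlam0 : 0 ≤ Real.log (1 / a) := Real.log_nonneg (by rwa [le_div_iff₀ ha0, one_mul])
  -- if `a` is so small that `s` is less than `√n`, then `log (1 / a)` is of order `log n`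
  have hsK : K * Real.log n ≤ s := by
    by_cases hsn : √n ≤ s
    · exact hnK.trans hsn
    · push Not at hsn
      rw [hp, div_lt_one hs0] at hp1
      have h1 : Real.log s < 1 / 2 * Real.log n := by
        have := Real.log_lt_log hs0 hsn
        rw [Real.log_sqrt hn0.le] at this
        linarith
      have h2 : Real.log s = -((Δ + 1) * Real.log (1 / a)) + Real.log n := by
        rw [hsdef, Real.log_mul (by positivity) hn0.ne', Real.log_pow, one_div, Real.log_inv]
        push_cast
        ring
      have h3 := mul_le_mul_of_nonneg_right hCK hlam0
      have h4 : K * Real.log n ≤ K * (2 * ((Δ + 1) * Real.log (1 / a))) := by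
        gcongr
        linarith
      linarith
  have hκs : Real.log n ≤ κ * s := by
    have h1 : 1 / κ * Real.log n ≤ s := by
      refine le_trans ?_ hsK
      gcongr
      rw [hK]
      have : (0 : ℝ) ≤ 32 * (Δ + 1) ^ 2 := by positivity
      linarith
    calc Real.log n = κ * (1 / κ * Real.log n) := by field_simp
      _ ≤ _ := by gcongr
  have hs32 : 32 * (Δ + 1) ^ 2 * Real.log n ≤ s := by
    refine le_trans ?_ hsK
    gcongr
    rw [hK]
    have : 0 ≤ 1 / κ := by positivity
    linarith
  set m := ⌊κ * s⌋₊ with hm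
  have hm1 : (m : ℝ) ≤ κ * s := Nat.floor_le (by positivity)
  have hm2 : κ * s < m + 1 := Nat.lt_floor_add_one _
  have hmpos : 1 ≤ m := Nat.le_floor (by push_cast; linarith)
  have hmn : (2 * Δ + 6) * m < n := by
    have h1 : s ≤ n := by
      rw [hsdef]
      exact mul_le_of_le_one_left hn0.le (pow_le_one₀ ha0.le ha1')
    have h2 : (2 * (Δ : ℝ) + 6) * κ < 1 := by
      rw [hκ, mul_one_div, div_lt_one (by positivity)]
      have h3 : (1 : ℝ) ≤ (Δ + 3) ^ 3 := one_le_pow₀ (by linarith)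
      nlinarith
    have h3 : ((2 * Δ + 6) * m : ℝ) < n := by
      calc ((2 * Δ + 6) * m : ℝ) ≤ (2 * Δ + 6) * (κ * n) := by
            gcongr
            exact hm1.trans (by gcongr)
        _ = (2 * Δ + 6) * κ * n := by ring
        _ < 1 * n := by gcongr
        _ = n := one_mul _
    exact_mod_cast h3
  have hC0 : 0 ≤ C := le_trans (by positivity) hCK
  have hp0 : 0 ≤ p := by
    rw [hp]
    positivity
  have hjoin : (gnp n p).real {H | ¬ IsJoined H m} ≤ Real.exp 1 / n := by
    refine (gnp_real_not_isJoined_le hp0 hp1.le m).trans ((choose_sq_mul_pow_le hΔ ha0 ha1 hκ0 hκ1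
      hn hmpos (by linarith) hC hp hp1.le).trans ?_)
    calc Real.exp (-m) ≤ Real.exp (1 - Real.log n) := Real.exp_le_exp.2 (by linarith)
      _ = _ := by rw [Real.exp_sub, Real.exp_log hn0]
  have habs := absorbers_error_le (m := m) hn hs0.le hκ hm1 hs32
  have h := one_sub_le_perturbedContainProb (G := G) (T := T) (p := p) (m := m)
    (b := 32 * Real.exp 1 ^ 4 / n) (by positivity) hjoin (by
      intro H hH
      refine (Nat.cast_le.2 (card_perm_not_isContained_le hT hTΔ hH hmpos hmn)).trans ?_
      have h1 := card_perm_absorbers_lt_le (G := G) (T := T) ha0.le ha1'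
        (by simpa using hG) hTΔ ((Δ + 3) * ((2 * Δ + 6) * m) + 1)
      rw [Fintype.card_fin] at h1
      refine le_trans (Nat.cast_le.2 (card_le_card fun φ hφ => ?_))
        (h1.trans (mul_le_mul_of_nonneg_right habs (by positivity)))
      simp only [mem_filter] at hφ ⊢
      exact hφ)
  rwa [← add_div] at h

theorem perturbedContainProb_eq_one {n : ℕ} {G T : SimpleGraph (Fin n)} (h : T ⊑ G) (p : ℝ) :
    perturbedContainProb G T p = 1 := by
  have : {H : SimpleGraph (Fin n) | T ⊑ G ⊔ H} = Set.univ :=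
    Set.eq_univ_of_forall fun H => h.mono_right le_sup_left
  rw [perturbedContainProb, this, probReal_univ]

theorem perturbedContainProb_of_one_le {n : ℕ} (G T : SimpleGraph (Fin n)) {p : ℝ}
    (hp : 1 ≤ p) : perturbedContainProb G T p = 1 := by
  have h : (⊤ : SimpleGraph (Fin n)) ∈ {H : SimpleGraph (Fin n) | T ⊑ G ⊔ H} := by
    have : T ⊑ (⊤ : SimpleGraph (Fin n)) := SimpleGraph.IsContained.of_le le_top
    simpa using this
  rw [perturbedContainProb, gnp_of_one_le hp, Measure.real, Measure.dirac_apply_of_mem h]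
  rfl

/-- A graph of minimum degree close to `n` contains every spanning tree of bounded degree. -/
theorem isContained_of_lt_minDegree {n Δ : ℕ} {a : ℝ} (hΔ : 1 ≤ Δ) (ha : 1 - 1 / (4 * Δ) < a)
    {G T : SimpleGraph (Fin n)} (hn : 0 < n)
    (hG : ∀ v, a * n ≤ (univ.filter fun w => G.Adj v w).card)
    (hT : ∀ v, (univ.filter fun w => T.Adj v w).card ≤ Δ) : T ⊑ G := by
  have hn0 : (0 : ℝ) < n := by exact_mod_cast hn
  have hΔ0 : (1 : ℝ) ≤ Δ := by exact_mod_cast hΔ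
  have hdeg : ∀ v, (((univ.filter fun w => Gᶜ.Adj v w).card : ℝ) + 1) * (4 * Δ) < n := by
    intro v
    have h1 : (univ.filter fun w => Gᶜ.Adj v w).card + (univ.filter fun w => G.Adj v w).card + 1 ≤
        n := by
      have hd : Disjoint (univ.filter fun w => Gᶜ.Adj v w) (univ.filter fun w => G.Adj v w) :=
        disjoint_left.2 fun w hw hw' => by
          simp only [mem_filter, mem_univ, true_and, SimpleGraph.compl_adj] at hw hw'
          exact hw.2 hw'
      rw [← card_union_of_disjoint hd, ← card_insert_of_notMem (a := v) (by simp)]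
      exact (card_le_univ _).trans_eq (Fintype.card_fin n)
    have h2 : ((univ.filter fun w => Gᶜ.Adj v w).card : ℝ) +
        (univ.filter fun w => G.Adj v w).card + 1 ≤ n := by exact_mod_cast h1
    have h3 : ((univ.filter fun w => Gᶜ.Adj v w).card : ℝ) + 1 < 1 / (4 * Δ) * n := by
      have h4 : (1 - a) * n < 1 / (4 * Δ) * n := by
        gcongr
        linarith
      linarith [hG v]
    rw [one_div, inv_mul_eq_div] at h3
    rwa [lt_div_iff₀ (by positivity)] at h3
  obtain ⟨v, -, hv⟩ := exists_max_image (univ : Finset (Fin n))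
    (fun v => (univ.filter fun w => Gᶜ.Adj v w).card) ⟨⟨0, hn⟩, mem_univ _⟩
  refine isContained_of_compl_degree_le hT (fun w => hv w (mem_univ _)) ?_
  have h1 := hdeg v
  rw [Fintype.card_fin]
  have h2 : ((2 * Δ * (univ.filter fun w => Gᶜ.Adj v w).card + 1 : ℕ) : ℝ) < n := by
    push_cast
    have : (0 : ℝ) ≤ (univ.filter fun w => Gᶜ.Adj v w).card := Nat.cast_nonneg _
    nlinarith
  exact_mod_cast h2

end RandomlyPerturbedTrees

theorem mainTheorem4 (Δ : ℕ) (hΔ : 2 ≤ Δ) :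
    ∃ C : ℝ, 0 < C ∧
      ∀ α : ℕ → ℝ, (∀ n, 0 < α n ∧ α n < 1) →
      ∀ β : ℕ → ℝ, (∀ n, β n = C * (α n ^ (Δ + 1))⁻¹ * Real.log (1 / α n)) →
      -- a.a.s., uniformly over the deterministic graph `G` and the tree `T`
      ∀ δ : ℝ, 0 < δ → ∀ᶠ n : ℕ in atTop,
        ∀ (G T : SimpleGraph (Fin n)) [DecidableRel G.Adj] [DecidableRel T.Adj],
          α n * (n : ℝ) ≤ (G.minDegree : ℝ) → T.IsTree → T.maxDegree ≤ Δ →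
            1 - δ ≤ perturbedContainProb G T (β n / (n : ℝ)) := by
  obtain ⟨κ, hκ⟩ : ∃ κ : ℝ, κ = 1 / (8 * (Δ + 3) ^ 4) := ⟨_, rfl⟩
  obtain ⟨K, hK⟩ : ∃ K : ℝ, K = 32 * (Δ + 1) ^ 2 + 1 / κ := ⟨_, rfl⟩
  have hκ0 : 0 < κ := by
    rw [hκ]
    positivity
  have hK0 : 0 < K := by
    rw [hK]
    positivity
  set A : ℝ := 8 * Δ * Real.log (2 * Real.exp 1 / κ) + 2 * (Δ + 1) + 4 * Δ with hA
  -- the first bound makes `α ^ (Δ + 1) * n` large compared with `log n`, the second one pays for the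
  -- union bound in `choose_sq_mul_pow_le`
  refine ⟨max (2 * (Δ + 1) * K) (2 * A / κ), lt_max_of_lt_left (by positivity), ?_⟩
  intro α hα β hβ δ hδ
  have hlog : ∀ᶠ n : ℕ in atTop, 2 ≤ Real.log n :=
    (Real.tendsto_log_atTop.comp tendsto_natCast_atTop_atTop).eventually_ge_atTop 2
  have hsqrt : ∀ᶠ n : ℕ in atTop, K * Real.log n ≤ √n := by
    have h1 := (isLittleO_log_rpow_atTop (r := 1 / 2) (by norm_num)).bound
      (c := 1 / K) (by positivity)
    filter_upwards [tendsto_natCast_atTop_atTop.eventually h1, hlog] with n hn hn2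
    rw [Real.norm_of_nonneg (by linarith), Real.norm_of_nonneg (by positivity),
      ← Real.sqrt_eq_rpow, one_div, inv_mul_eq_div, le_div_iff₀ hK0] at hn
    linarith
  have hδn : ∀ᶠ n : ℕ in atTop, (Real.exp 1 + 32 * Real.exp 1 ^ 4) / (n : ℝ) < δ :=
    (tendsto_const_div_atTop_nhds_zero_nat _).eventually_lt_const hδ
  filter_upwards [hlog, hsqrt, hδn, eventually_gt_atTop 0] with n hn2 hnK hnδ hn0
  intro G T _ _ hG hT hTΔ
  have hG' : ∀ v, α n * n ≤ (Finset.univ.filter fun w => G.Adj v w).card := by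
    intro v
    refine hG.trans (Nat.cast_le.2 ((G.minDegree_le_degree v).trans_eq ?_))
    rw [← G.card_neighborFinset_eq_degree, SimpleGraph.neighborFinset_eq_filter]
  have hT' : ∀ v, (Finset.univ.filter fun w => T.Adj v w).card ≤ Δ := by
    intro v
    refine le_trans (Eq.le ?_) ((T.degree_le_maxDegree v).trans hTΔ)
    rw [← T.card_neighborFinset_eq_degree, SimpleGraph.neighborFinset_eq_filter]
  have hΔ1 : 1 ≤ Δ := by omega
  by_cases hα1 : α n ≤ 1 - 1 / (4 * Δ)
  · by_cases hβn : β n / n < 1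
    · have hC : A ≤ max (2 * (Δ + 1) * K) (2 * A / κ) * κ / 2 := by
        calc A = 2 * A / κ * κ / 2 := by field_simp
          _ ≤ _ := by
            gcongr
            exact le_max_right _ _
      have hp : β n / n = max (2 * (Δ + 1) * K) (2 * A / κ) * Real.log (1 / α n) /
          (α n ^ (Δ + 1) * n) := by
        have := (hα n).1
        rw [hβ n]
        field_simp
      have := one_sub_div_le_perturbedContainProb hΔ1 hκ hK hC (le_max_left _ _) (hα n).1 hα1
        hn2 hnK hp hβn (by convert hG') hT (by convert hT')
      linarith
    · rw [perturbedContainProb_of_one_le G T (not_lt.1 hβn)]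
      linarith
  · rw [perturbedContainProb_eq_one (isContained_of_lt_minDegree hΔ1 (not_le.1 hα1) hn0
      (by convert hG') (by convert hT'))]
    linarith
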